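/- For $d\in\mathbb N$, a connection is a function $\sigma:\{\pm1\}^d\to[0,1]$; its mean is $p=\mathbf E_{x\sim\mathrm{Unif}\{\pm1\}^d}[\sigma(x)]$. $\mathsf{RAG}(n,\{\pm1\}^d,p,\sigma)$ is the law of the random graph on $\{1,\dots,n\}$ obtained by drawing $x_1,\dots,x_n$ independently and uniformly from $\{\pm1\}^d$ and then, conditionally on them, joining each pair $i<j$ independently with probability $\sigma(x_ix_j)$, where $x_ix_j$ is the coordinatewise product. $\mathsf G(n,p)$ is the Erdős–Rényi (binomial) random graph and $\mathsf{KL}$ is the Kullback–Leibler divergence. The connection $\sigma$ is symmetric if it is invariant under permutations of the coordinates, and even if $\sigma(-x)=\sigma(x)$ for all $x$. For symmetric $\sigma$ let $\sigma_i$ be its value at points with exactly $i$ coordinates equal to $1$, and let $\mathsf{Fl}(\sigma)=\sum_{i=0}^{d-1}|\sigma_{i+1}-\sigma_i|$ be its fluctuation. There is an absolute constant $K>0$ with the following properties. Let $d=d(n)$ be a sequence of dimensions and $\sigma=\sigma^{(n)}$ a sequence of symmetric connections on $\{\pm1\}^{d(n)}$ with means $p=p(n)$, and suppose that $p$ is bounded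 away from $1$, that is, there is a constant $c>0$ with $p(n)\le 1-c$ for all large $n$. All asymptotic notation is for $n\to\infty$. In conditions (1)–(3), if $p(n)=0$ for some $n$, the maximum is read as $0$ for that $n$ (then $\sigma\equiv0$ and the divergence is $0$). 1. If $d\ge Kn\log n$ for all large $n$ and $$d=\omega\Big(\max\Big(n^3p^2\log^2\tfrac1p,\; n^{3/2}\,\mathsf{Fl}(\sigma)^2p^{-1}\Big)\Big),$$ then $\mathsf{KL}\big(\mathsf{RAG}(n,\{\pm1\}^d,p,\sigma)\,\|\,\mathsf G(n,p)\big)=o(1)$. 2. If $\sigma$ and $d$ are even and $d\ge Kn\log n$ for all large $n$, then the same conclusion holds under the weaker condition $$d=\omega\Big(\max\Big(n^{3/2}p\log^2\tfrac1p,\; n^{3/2}\,\mathsf{Fl}(\sigma)^2p^{-1}\Big)\Big).$$ 3. Suppose that $\sigma(x)=\mathbf 1\big[\sum_i x_i\in I\big]$, where $I=I^{(n)}=[a_1,b_1]\cup\dots\cup[a_s,b_s]$ is a union of $s=s(n)$ disjoint integer intervals ($a_i\le b_i$ and $b_i+1<a_{i+1}$). Then part 1 holds with $\mathsf{Fl}(\sigma)$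 replaced by $2s$, and, if $d$ is even and $I=-I$ for all large $n$, so does part 2. 4. In the setting of part 3, suppose also that $p=\Omega(1)$. If $d=\omega(n^3+n^{3/2}s^2)$, then $\mathsf{KL}\big(\mathsf{RAG}(n,\{\pm1\}^d,p,\sigma)\,\|\,\mathsf G(n,p)\big)=o(1)$. If $d$ is even and $I=-I$ for all large $n$, then $d=\omega(n^{3/2}s^2)$ is sufficient. -/

import Mathlib

open MeasureTheory Filter Asymptotics Topology Finset

noncomputable section

/-- The hypercube `{±1}^d`, a group under coordinatewise multiplication. -/
abbrev Hypercube (d : ℕ) : Type := Fin d → ℤˣ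

/-- A connection on the hypercube: two latent vectors `x, y` are joined with probability
`σ (x * y) ∈ [0, 1]`. -/
abbrev Connection (d : ℕ) : Type := Hypercube d → unitInterval

namespace Connection

variable {d : ℕ}

/-- Invariance under all permutations of the coordinates. -/
def IsSymmetric (σ : Connection d) : Prop :=
  ∀ (π : Equiv.Perm (Fin d)) (x : Hypercube d), σ (fun i => x (π i)) = σ x

/-- `σ x = σ (-x)` for all `x`. -/
def IsEven (σ : Connection d) : Prop := ∀ x : Hypercube d, σ (-x) = σ x

/-- The expectation of `σ` under the uniform distribution on the hypercube. -/
def mean (σ : Connection d) : unitInterval :=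
  ⟨(∑ x : Hypercube d, (σ x : ℝ)) / Fintype.card (Hypercube d), by
    have hc : (0 : ℝ) < Fintype.card (Hypercube d) := by
      exact_mod_cast Fintype.card_pos
    refine ⟨div_nonneg (Finset.sum_nonneg fun x _ => (σ x).2.1) hc.le, ?_⟩
    rw [div_le_one hc]
    calc (∑ x : Hypercube d, (σ x : ℝ)) ≤ ∑ _x : Hypercube d, (1 : ℝ) :=
          Finset.sum_le_sum fun x _ => (σ x).2.2
      _ = Fintype.card (Hypercube d) := by simp⟩

/-- The point `(1, …, 1, -1, …, -1)` whose first `i` coordinates are `1`. -/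
def levelPoint (d i : ℕ) : Hypercube d := fun k => if (k : ℕ) < i then 1 else -1

/-- The fluctuation `∑_{i = 0}^{d - 1} |σ_{i+1} - σ_i|`, where `σ_i` is the value of the symmetric
connection `σ` on the points with exactly `i` coordinates equal to `1`. -/
def fluctuation (σ : Connection d) : ℝ :=
  ∑ i ∈ Finset.range d, |(σ (levelPoint d (i + 1)) : ℝ) - (σ (levelPoint d i) : ℝ)|

open Classical in
/-- The indicator of the event `∑ i, x i ∈ I`. -/
def sumIndicator (d : ℕ) (I : Set ℤ) : Connection d :=
  fun x => if (∑ i, ((x i : ℤˣ) : ℤ)) ∈ I then 1 else 0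

open Classical in
/-- The conditional probability of the graph `G` given the latent vectors `x`, where the pairs
`i < j` are joined independently with probabilities `σ (x i * x j)`. -/
def likelihood {n : ℕ} (σ : Connection d) (x : Fin n → Hypercube d)
    (G : SimpleGraph (Fin n)) : ℝ :=
  ∏ e ∈ Finset.univ.filter (fun e : Fin n × Fin n => e.1 < e.2),
    if G.Adj e.1 e.2 then (σ (x e.1 * x e.2) : ℝ) else 1 - (σ (x e.1 * x e.2) : ℝ)

/-- The probability of the graph `G` when the `n` latent vectors are independent and uniform. -/
def ragMass {n : ℕ} (σ : Connection d) (G : SimpleGraph (Fin n)) : ℝ :=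
  (∑ x : Fin n → Hypercube d, σ.likelihood x G) / Fintype.card (Fin n → Hypercube d)

open Classical in
/-- The law `RAG(n, {±1}^d, p, σ)` of the random algebraic graph on `n` vertices with latent space
the hypercube and connection `σ`; here `p` is the mean of `σ`. -/
def rag (n : ℕ) (σ : Connection d) : Measure (SimpleGraph (Fin n)) :=
  ∑ G : SimpleGraph (Fin n), ENNReal.ofReal (σ.ragMass G) • Measure.dirac G

/-- The Kullback-Leibler divergence of `RAG(n, {±1}^d, p, σ)` from `G(n, p)`, `p` the mean of
`σ`. -/
def klToBinomial (n : ℕ) (σ : Connection d) : ENNReal :=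
  InformationTheory.klDiv (σ.rag n) (SimpleGraph.binomialRandom (Fin n) σ.mean)

end Connection

/-- `I` is a union of `s` disjoint integer intervals `[a 0, b 0], …, [a (s-1), b (s-1)]`, listed in
increasing order with at least one missing integer between consecutive ones. -/
def IsIntervalUnion (s : ℕ) (I : Set ℤ) : Prop :=
  ∃ a b : Fin s → ℤ, (∀ i, a i ≤ b i) ∧ (∀ i j, i < j → b i + 1 < a j) ∧
    I = ⋃ i, Set.Icc (a i) (b i)

end

/-! Reveal the vertices one at a time. Given the earlier latent vectors, the edges to a new vertex
follow a mixture over its own latent vector. The chain rule with Jensen's inequality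
(`sum_mul_log_le_of_mixture`) bounds the cost of that vertex by the logarithm of a second moment.
Squaring the mixture produces two independent copies of the new latent vector, and with k earlier
vertices the second moment is E(1 + γ)^k (`expect_chiSq`). Here γ is `corr σ p`, the centred
autocorrelation of σ over p(1 - p). As γ has mean zero the linear term drops out, and the divergence
is at most 2n E[cosh(nγ) - 1] (`klToBinomial_le_cosh`).

For symmetric σ, γ = ∑ w_i κ_i over 1 ≤ i ≤ d, where κ_i is `kraw i` and the w_i are nonnegative
Fourier weights of total at most 1. Convexity of cosh reduces matters to the moments E cosh(aκ_i).
On the (d+1)-cube κ_{i+1} is a signed average of copies of κ_i on the d-cube, so by Jensen the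
moment does not increase from (d, i) to (d+1, i+1). Since κ_{d-i} = ±κ_i pointwise, all levels from
3 to d - 3 are dominated by level 3 in dimension at least d/2; together they cost only O(n³/d³).

Only levels 1, 2, d-2, d-1 and d need bounds on w_i. An entropy argument gives w_1 = O(p log(1/p))
and w_2 = O(p log²(1/p)); multiplication by the parity character carries these to d-1 and d-2.
Pairing points that differ in one coordinate gives w_d = O(Fl²/(dp)).
`klToBinomial_le_of_relWeight_le` assembles the estimates, and the hypotheses on d make each term
vanish. When σ and d are even, levels 1 and d-1 carry no weight, which removes the strongest
condition. -/

open scoped BigOperators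

/-! ### Walsh characters and Rademacher sums -/

namespace Hypercube

/-- The coordinate `x j` as a real number. -/
def coord {d : ℕ} (x : Hypercube d) (j : Fin d) : ℝ := ((x j : ℤ) : ℝ)

/-- The sum of the coordinates. -/
def total {d : ℕ} (x : Hypercube d) : ℝ := ∑ j, coord x j

/-- The Walsh character `x ↦ ∏ j ∈ S, x j`. -/
def walsh {d : ℕ} (S : Finset (Fin d)) (x : Hypercube d) : ℝ := ∏ j ∈ S, coord x j

/-- The elementary symmetric polynomial of degree `i` in the coordinates. -/
def esymm {d : ℕ} (i : ℕ) (x : Hypercube d) : ℝ := ∑ S ∈ powersetCard i univ, walsh S x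

/-- The average of the Walsh characters of degree `i`, a normalized Krawtchouk polynomial. -/
noncomputable def kraw {d : ℕ} (i : ℕ) (x : Hypercube d) : ℝ := esymm i x / d.choose i

variable {d : ℕ}

lemma coord_eq (x : Hypercube d) (j : Fin d) : coord x j = 1 ∨ coord x j = -1 := by
  rcases Int.units_eq_one_or (x j) with h | h <;> simp [coord, h]

lemma coord_sq (x : Hypercube d) (j : Fin d) : coord x j ^ 2 = 1 := by
  rcases coord_eq x j with h | h <;> simp [h]

lemma abs_coord (x : Hypercube d) (j : Fin d) : |coord x j| = 1 := by
  rcases coord_eq x j with h | h <;> simp [h]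

lemma coord_mul (x y : Hypercube d) (j : Fin d) : coord (x * y) j = coord x j * coord y j := by
  simp [coord]

lemma walsh_sq (S : Finset (Fin d)) (x : Hypercube d) : walsh S x ^ 2 = 1 := by
  simp [walsh, ← Finset.prod_pow, coord_sq]

lemma abs_walsh (S : Finset (Fin d)) (x : Hypercube d) : |walsh S x| = 1 := by
  simp [walsh, Finset.abs_prod, abs_coord]

lemma walsh_mul (S : Finset (Fin d)) (x y : Hypercube d) :
    walsh S (x * y) = walsh S x * walsh S y := by
  simp [walsh, coord_mul, Finset.prod_mul_distrib]

lemma abs_total_le (x : Hypercube d) : |total x| ≤ d := by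
  refine (Finset.abs_sum_le_sum_abs _ _).trans ?_
  simp [abs_coord]

lemma sum_units_int (f : ℤˣ → ℝ) : ∑ u, f u = f 1 + f (-1) := by
  rw [UnitsInt.univ, Finset.sum_insert (by decide), Finset.sum_singleton]

lemma expect_insertNth (j : Fin (d + 1)) (F : Hypercube (d + 1) → ℝ) :
    𝔼 x, F x = 𝔼 y : Hypercube d, (F (j.insertNth 1 y) + F (j.insertNth (-1) y)) / 2 := by
  rw [← Fintype.expect_equiv (Fin.insertNthEquiv (fun _ => ℤˣ) j)
    (fun q => F (j.insertNth q.1 q.2)) F (fun _ => rfl), ← univ_product_univ, expect_product,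
    expect_comm]
  refine expect_congr rfl fun y _ => ?_
  rw [Fintype.expect_eq_sum_div_card, sum_units_int]
  simp

lemma expect_comp_succAbove (j : Fin (d + 1)) (F : Hypercube d → ℝ) :
    𝔼 x : Hypercube (d + 1), F (fun k => x (j.succAbove k)) = 𝔼 y, F y := by
  rw [expect_insertNth j]
  simp

lemma total_insertNth (j : Fin (d + 1)) (u : ℤˣ) (y : Hypercube d) :
    total (j.insertNth (α := fun _ => ℤˣ) u y : Hypercube (d + 1)) = ((u : ℤ) : ℝ) + total y := by
  simp [total, coord, Fin.sum_univ_succAbove _ j]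

lemma total_succAbove (j : Fin (d + 1)) (x : Hypercube (d + 1)) :
    total (fun k => x (j.succAbove k)) = total x - coord x j := by
  simp [total, coord, Fin.sum_univ_succAbove _ j]

/-- The square of a normalized Rademacher sum is subexponential. -/
lemma expect_exp_total_sq_le (d : ℕ) : ∀ a : ℝ, 2 * d < a →
    𝔼 x : Hypercube d, Real.exp (total x ^ 2 / a) ≤ Real.exp (d / (a - 2 * d)) := by
  induction d with
  | zero => intro a _; simp [total]
  | succ d ih =>
    intro a ha
    push_cast at ha ⊢
    have hd : (0 : ℝ) ≤ d := Nat.cast_nonneg d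
    have ha0 : 0 < a := by linarith
    have ha2 : 0 < a - 2 := by linarith
    have key (s : ℝ) : (Real.exp ((1 + s) ^ 2 / a) + Real.exp ((-1 + s) ^ 2 / a)) / 2
        ≤ Real.exp (1 / a) * Real.exp (s ^ 2 / (a - 2)) := by
      have h1 : (1 + s) ^ 2 / a = (1 / a + s ^ 2 / a) + 2 * s / a := by ring
      have h2 : (-1 + s) ^ 2 / a = (1 / a + s ^ 2 / a) + -(2 * s / a) := by ring
      have h3 : (Real.exp ((1 + s) ^ 2 / a) + Real.exp ((-1 + s) ^ 2 / a)) / 2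
          = Real.exp (1 / a + s ^ 2 / a) * Real.cosh (2 * s / a) := by
        rw [h1, h2, Real.exp_add, Real.exp_add (1 / a + s ^ 2 / a) (-(2 * s / a)), Real.cosh_eq]
        ring
      rw [h3, ← Real.exp_add]
      refine (mul_le_mul_of_nonneg_left (Real.cosh_le_exp_half_sq _)
        (Real.exp_pos _).le).trans ?_
      rw [← Real.exp_add, Real.exp_le_exp]
      have h4 : s ^ 2 / a + (2 * s / a) ^ 2 / 2 = s ^ 2 * ((a + 2) / a ^ 2) := by
        field_simp
      -- Lowering `a` by 2 per coordinate absorbs the cosh factor, because (a + 2)(a - 2) ≤ a².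
      have h5 : (a + 2) / a ^ 2 ≤ 1 / (a - 2) := by
        rw [div_le_div_iff₀ (by positivity) ha2]
        nlinarith
      have h6 := mul_le_mul_of_nonneg_left h5 (sq_nonneg s)
      rw [mul_one_div] at h6
      linarith
    rw [expect_insertNth 0]
    calc 𝔼 y : Hypercube d, _ ≤ 𝔼 y : Hypercube d,
          Real.exp (1 / a) * Real.exp (total y ^ 2 / (a - 2)) := by
            refine expect_le_expect fun y _ => ?_
            simp only [total_insertNth]
            simpa using key (total y)
      _ ≤ Real.exp (1 / a) * Real.exp (d / (a - 2 - 2 * d)) := by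
            rw [← mul_expect]
            exact mul_le_mul_of_nonneg_left (ih _ (by linarith)) (Real.exp_pos _).le
      _ ≤ _ := by
            rw [← Real.exp_add, Real.exp_le_exp]
            have h7 : 0 < a - 2 * (d + 1) := by linarith
            have h8 : a - 2 - 2 * (d : ℝ) = a - 2 * (d + 1) := by ring
            have h9 : 1 / a ≤ 1 / (a - 2 * (d + 1)) :=
              one_div_le_one_div_of_le h7 (by linarith)
            rw [h8, add_div, add_comm]
            linarith

/-- The choice a = 4d leaves exp(1/2). This single moment drives both the cosh moments of low degree
and the level inequalities. -/
lemma expect_exp_total_sq_le_two (hd : 0 < d) :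
    𝔼 x : Hypercube d, Real.exp (total x ^ 2 / (4 * d)) ≤ 2 := by
  have hd' : (0 : ℝ) < d := by exact_mod_cast hd
  refine (expect_exp_total_sq_le d (4 * d) (by linarith)).trans ?_
  have h : (d : ℝ) / (4 * d - 2 * d) = 1 / 2 := by field_simp; norm_num
  rw [h]
  have h1 : Real.exp (1 / 2) ^ 2 = Real.exp 1 := by
    rw [← Real.exp_nat_mul]; norm_num
  nlinarith [Real.exp_one_lt_d9, Real.exp_pos (1 / 2 : ℝ)]

/-! ### Recursion for the elementary symmetric polynomials -/

lemma walsh_map_succAbove (j : Fin (d + 1)) (T : Finset (Fin d)) (x : Hypercube (d + 1)) :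
    walsh (T.map j.succAboveEmb) x = walsh T (fun k => x (j.succAbove k)) := by
  simp [walsh, coord]

lemma sum_walsh_mem (j : Fin (d + 1)) (i : ℕ) (x : Hypercube (d + 1)) :
    ∑ S ∈ powersetCard (i + 1) univ with j ∈ S, walsh S x
      = coord x j * esymm i (fun k => x (j.succAbove k)) := by
  have hj (T : Finset (Fin d)) : j ∉ T.map j.succAboveEmb := by
    simp [Fin.succAbove_ne]
  rw [esymm, mul_sum]
  symm
  refine Finset.sum_bij (fun T _ => insert j (T.map j.succAboveEmb)) ?_ ?_ ?_ ?_
  · intro T hT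
    simp only [mem_powersetCard_univ, mem_filter] at hT ⊢
    simp [card_insert_of_notMem (hj T), hT]
  · intro T _ T' _ h
    have := congrArg (fun A => A.erase j) h
    simpa [erase_insert (hj _)] using this
  · intro S hS
    simp only [mem_powersetCard_univ, mem_filter] at hS
    refine ⟨univ.filter (fun k => j.succAbove k ∈ S), ?_, ?_⟩
    · have : insert j ((univ.filter (fun k => j.succAbove k ∈ S)).map j.succAboveEmb) = S := by
        ext k
        rcases Fin.eq_self_or_eq_succAbove j k with rfl | ⟨k, rfl⟩ <;>
          simp [hS.2, Fin.succAbove_ne]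
      have h2 := congrArg Finset.card this
      rw [card_insert_of_notMem (hj _), card_map, hS.1] at h2
      simpa using h2
    · ext k
      rcases Fin.eq_self_or_eq_succAbove j k with rfl | ⟨k, rfl⟩ <;>
        simp [hS.2, Fin.succAbove_ne]
  · intro T _
    conv_rhs => rw [walsh, prod_insert (hj T)]
    rw [← walsh_map_succAbove]
    rfl

/-- Double counting of the pairs j ∈ S with #S = i + 1. -/
lemma esymm_succ (i : ℕ) (x : Hypercube (d + 1)) :
    (i + 1) * esymm (i + 1) x = ∑ j, coord x j * esymm i (fun k => x (j.succAbove k)) := by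
  simp_rw [← sum_walsh_mem, Finset.sum_filter]
  rw [Finset.sum_comm, esymm, mul_sum]
  refine Finset.sum_congr rfl fun S hS => ?_
  rw [mem_powersetCard_univ] at hS
  rw [← Finset.sum_filter, Finset.sum_const, filter_univ_mem, hS]
  simp

/-- After normalization the recursion becomes an exact average with signs, which is the form
Jensen's inequality needs. -/
lemma kraw_succ {i : ℕ} (hi : i ≤ d) (x : Hypercube (d + 1)) :
    kraw (i + 1) x = 𝔼 j, coord x j * kraw i (fun k => x (j.succAbove k)) := by
  have h1 := esymm_succ i x
  have h2 : ((d + 1 : ℕ) : ℝ) * (d.choose i : ℝ) = ((d + 1).choose (i + 1) : ℝ) * (i + 1) := by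
    exact_mod_cast Nat.add_one_mul_choose_eq d i
  have h3 : (0 : ℝ) < d.choose i := by exact_mod_cast Nat.choose_pos hi
  have h4 : (0 : ℝ) < (d + 1).choose (i + 1) := by
    exact_mod_cast Nat.choose_pos (by omega)
  rw [Fintype.expect_eq_sum_div_card]
  simp only [kraw, mul_div_assoc', ← Finset.sum_div, Fintype.card_fin]
  rw [← h1, div_div, div_eq_div_iff h4.ne' (by positivity)]
  push_cast at h2 ⊢
  linear_combination esymm (i + 1) x * h2

lemma esymm_zero (x : Hypercube d) : esymm 0 x = 1 := by
  simp [esymm, walsh]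

lemma esymm_one (x : Hypercube d) : esymm 1 x = total x := by
  simp [esymm, total, powersetCard_one, walsh]

lemma esymm_two (x : Hypercube d) : esymm 2 x = (total x ^ 2 - d) / 2 := by
  cases d with
  | zero =>
    rw [esymm, powersetCard_eq_empty.2 (by simp)]
    simp [total]
  | succ d =>
    have h := esymm_succ 1 x
    simp only [esymm_one, total_succAbove, mul_sub, ← pow_two, coord_sq, Finset.sum_sub_distrib,
      ← Finset.sum_mul] at h
    simp only [sum_const, card_univ, Fintype.card_fin, nsmul_eq_mul] at h
    have h' : ∑ j, coord x j = total x := rfl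
    rw [h'] at h
    norm_num at h ⊢
    linarith

lemma esymm_three (x : Hypercube d) :
    esymm 3 x = (total x ^ 3 - (3 * d - 2) * total x) / 6 := by
  cases d with
  | zero =>
    rw [esymm, powersetCard_eq_empty.2 (by simp)]
    simp [total]
  | succ d =>
    have h := esymm_succ 2 x
    have h' : ∑ j, coord x j = total x := rfl
    have h2 (j : Fin (d + 1)) : coord x j * (((total x - coord x j) ^ 2 - d) / 2)
        = coord x j * ((total x ^ 2 + 1 - d) / 2) - total x := by
      linear_combination (coord x j / 2 - total x) * coord_sq x j
    simp only [esymm_two, total_succAbove, h2, Finset.sum_sub_distrib, ← Finset.sum_mul, h'] at h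
    simp only [sum_const, card_univ, Fintype.card_fin, nsmul_eq_mul] at h
    norm_num at h ⊢
    linarith

end Hypercube

/-! ### Convexity and growth of cosh -/

lemma Real.convexOn_cosh : ConvexOn ℝ Set.univ Real.cosh := by
  have h := (convexOn_exp.add (convexOn_exp.comp_linearMap (-LinearMap.id))).smul
    (show (0 : ℝ) ≤ 1 / 2 by norm_num)
  refine ConvexOn.congr (by simpa using h) fun x _ => ?_
  simp [Real.cosh_eq]
  ring

/-- With z = |y|, 2(cosh z - 1) = e^{-z}(e^z - 1)², and e^z - 1 ≤ z e^z. -/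
lemma Real.cosh_sub_one_le (y : ℝ) : Real.cosh y - 1 ≤ y ^ 2 * Real.exp |y| := by
  rw [← Real.cosh_abs, ← sq_abs]
  have hz := abs_nonneg y
  generalize |y| = z at *
  have hE : Real.exp (-z) * Real.exp z = 1 := by rw [← Real.exp_add]; simp
  have h1 : Real.exp z - 1 ≤ z * Real.exp z := by
    have h := mul_le_mul_of_nonneg_right (Real.add_one_le_exp (-z)) (Real.exp_pos z).le
    linarith
  have h2 : 0 ≤ Real.exp z - 1 := by linarith [Real.add_one_le_exp z]
  have h3 : (Real.exp z - 1) ^ 2 ≤ (z * Real.exp z) ^ 2 := pow_le_pow_left₀ h2 h1 2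
  have h4 := mul_le_mul_of_nonneg_left h3 (Real.exp_pos (-z)).le
  have h5 : Real.exp (-z) * (Real.exp z - 1) ^ 2 = 2 * (Real.cosh z - 1) := by
    rw [Real.cosh_eq]
    linear_combination (Real.exp z - 2) * hE
  have h6 : Real.exp (-z) * (z * Real.exp z) ^ 2 = z ^ 2 * Real.exp z := by
    linear_combination (z ^ 2 * Real.exp z) * hE
  have h7 : 0 ≤ z ^ 2 * Real.exp z := by positivity
  linarith

lemma Real.cosh_expect_le {ι : Type*} [Fintype ι] [Nonempty ι] (f : ι → ℝ) :
    Real.cosh (𝔼 j, f j) ≤ 𝔼 j, Real.cosh (f j) := by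
  have h := Real.convexOn_cosh.map_sum_le (t := univ) (w := fun _ : ι => (Fintype.card ι : ℝ)⁻¹)
    (p := f) (fun _ _ => by positivity) (by simp) (fun _ _ => Set.mem_univ _)
  simpa [Fintype.expect_eq_sum_div_card, Finset.mul_sum, div_eq_inv_mul] using h

/-! ### Exponential moments of Krawtchouk polynomials -/

namespace Hypercube

variable {d : ℕ}

lemma card_eq (d : ℕ) : (Fintype.card (Hypercube d) : ℝ) = 2 ^ d := by
  simp

lemma walsh_one (S : Finset (Fin d)) : walsh S 1 = 1 := by simp [walsh, coord]

lemma kraw_apply_one {i : ℕ} (hi : i ≤ d) : kraw i (1 : Hypercube d) = 1 := by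
  have h : (0 : ℝ) < d.choose i := by exact_mod_cast Nat.choose_pos hi
  simp [kraw, esymm, walsh_one, h.ne']

lemma walsh_compl (S : Finset (Fin d)) (x : Hypercube d) :
    walsh Sᶜ x = walsh univ x * walsh S x := by
  have h : walsh S x * walsh Sᶜ x = walsh univ x := Finset.prod_mul_prod_compl _ _
  linear_combination -walsh Sᶜ x * walsh_sq S x + walsh S x * h

/-- Complementation of index sets multiplies each character by the parity character. Hence high
levels behave like low ones up to sign. -/
lemma kraw_sub {i : ℕ} (hi : i ≤ d) (x : Hypercube d) :
    kraw (d - i) x = walsh univ x * kraw i x := by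
  rw [kraw, kraw, Nat.choose_symm hi, esymm, esymm, ← mul_div_assoc, mul_sum]
  congr 1
  refine Finset.sum_nbij' compl compl ?_ ?_ ?_ ?_ ?_
  · intro S hS
    simp only [mem_powersetCard_univ, card_compl, Fintype.card_fin] at hS ⊢
    omega
  · intro S hS
    simp only [mem_powersetCard_univ, card_compl, Fintype.card_fin] at hS ⊢
    omega
  · simp
  · simp
  · intro S _
    rw [← walsh_compl, compl_compl]

lemma cosh_kraw_sub {i : ℕ} (hi : i ≤ d) (a : ℝ) (x : Hypercube d) :
    Real.cosh (a * kraw (d - i) x) = Real.cosh (a * kraw i x) := by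
  rw [kraw_sub hi, ← Real.cosh_abs, ← Real.cosh_abs (a * kraw i x)]
  simp [abs_mul, abs_walsh]

/-- Jensen applied to `kraw_succ`: the signs disappear because cosh is even, and deleting a
coordinate of a uniform point leaves a uniform point. -/
lemma expect_cosh_kraw_succ {i : ℕ} (hi : i ≤ d) (a : ℝ) :
    𝔼 x : Hypercube (d + 1), Real.cosh (a * kraw (i + 1) x)
      ≤ 𝔼 x : Hypercube d, Real.cosh (a * kraw i x) := by
  calc 𝔼 x : Hypercube (d + 1), Real.cosh (a * kraw (i + 1) x)
      ≤ 𝔼 x : Hypercube (d + 1), 𝔼 j : Fin (d + 1),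
          Real.cosh (a * kraw i (fun k => x (j.succAbove k))) := by
        refine expect_le_expect fun x _ => ?_
        rw [kraw_succ hi, mul_expect]
        refine (Real.cosh_expect_le _).trans_eq (expect_congr rfl fun j _ => ?_)
        rw [← Real.cosh_abs, ← Real.cosh_abs (a * kraw i _)]
        simp [abs_mul, abs_coord]
    _ = 𝔼 x : Hypercube d, Real.cosh (a * kraw i x) := by
        rw [expect_comm]
        simp_rw [fun j : Fin (d + 1) =>
          expect_comp_succAbove j (fun y => Real.cosh (a * kraw i y))]
        simp

lemma expect_cosh_kraw_add {i : ℕ} (hi : i ≤ d) (a : ℝ) (k : ℕ) :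
    𝔼 x : Hypercube (d + k), Real.cosh (a * kraw (i + k) x)
      ≤ 𝔼 x : Hypercube d, Real.cosh (a * kraw i x) := by
  induction k with
  | zero => exact le_rfl
  | succ k ih => exact (expect_cosh_kraw_succ (d := d + k) (i := i + k) (by omega) a).trans ih

lemma kraw_one (x : Hypercube d) : kraw 1 x = total x / d := by
  simp [kraw, esymm_one]

lemma kraw_two (x : Hypercube d) : kraw 2 x = (total x ^ 2 - d) / (d * (d - 1)) := by
  rw [kraw, esymm_two, Nat.cast_choose_two, div_div_div_cancel_right₀ two_ne_zero]

lemma kraw_three (hd : 2 ≤ d) (x : Hypercube d) :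
    kraw 3 x = (total x ^ 3 - (3 * d - 2) * total x) / (d * (d - 1) * (d - 2)) := by
  have h : (d.choose 3 : ℝ) = d * (d - 1) * (d - 2) / 6 := by
    obtain ⟨e, rfl⟩ := Nat.exists_eq_add_of_le' hd
    have h1 := Nat.add_one_mul_choose_eq (e + 1) 2
    have h2 : (((e + 1 : ℕ) + 1 : ℕ) : ℝ) * ((e + 1).choose 2 : ℝ)
        = ((e + 1 + 1).choose 3 : ℝ) * ((2 + 1 : ℕ) : ℝ) := by exact_mod_cast h1
    rw [Nat.cast_choose_two] at h2
    push_cast at h2 ⊢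
    norm_num at h2 ⊢
    linear_combination -h2 / 3
  rw [kraw, esymm_three, h, div_div_div_cancel_right₀ (by norm_num)]

lemma expect_cosh_kraw_one (hd : 0 < d) {a : ℝ} (ha : 2 * a ^ 2 ≤ d) :
    𝔼 x : Hypercube d, (Real.cosh (a * kraw 1 x) - 1) ≤ 2 * a ^ 2 / d := by
  have hd' : (0 : ℝ) < d := by exact_mod_cast hd
  -- The bound cosh y ≤ exp(y²/2) has exponent θ · total²/(4d). Since θ ≤ 1, convexity of exp
  -- between 0 and total²/(4d) extracts the factor θ.
  set θ := 2 * a ^ 2 / d with hθ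
  have hθ0 : 0 ≤ θ := by positivity
  have hθ1 : θ ≤ 1 := (div_le_one hd').2 ha
  have key (x : Hypercube d) : Real.cosh (a * kraw 1 x) - 1
      ≤ θ * (Real.exp (total x ^ 2 / (4 * d)) - 1) := by
    have h1 := Real.cosh_le_exp_half_sq (a * kraw 1 x)
    have h2 : (a * kraw 1 x) ^ 2 / 2 = θ * (total x ^ 2 / (4 * d)) := by
      rw [kraw_one, hθ]; field_simp; norm_num
    have h3 := convexOn_exp.2 (Set.mem_univ (total x ^ 2 / (4 * d))) (Set.mem_univ 0) hθ0
      (sub_nonneg.2 hθ1) (by ring)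
    simp only [smul_eq_mul, mul_zero, add_zero, Real.exp_zero] at h3
    rw [h2] at h1
    linarith
  refine (expect_le_expect fun x _ => key x).trans ?_
  rw [← mul_expect, expect_sub_distrib]
  simp only [Fintype.expect_const]
  have := expect_exp_total_sq_le_two hd
  nlinarith

lemma expect_cosh_kraw_two (hd : 2 ≤ d) {a : ℝ} (ha : |a| ≤ (d - 1) / 8) :
    𝔼 x : Hypercube d, (Real.cosh (a * kraw 2 x) - 1) ≤ 400 * (a / (d - 1)) ^ 2 := by
  have hd' : (2 : ℝ) ≤ d := by exact_mod_cast hd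
  have hd0 : (d : ℝ) ≠ 0 := by linarith
  have hd1 : (0 : ℝ) < d - 1 := by linarith
  have hd1' := hd1.ne'
  set μ := a / (d - 1) with hμ
  have hμ1 : |μ| ≤ 1 / 8 := by
    rw [hμ, abs_div, abs_of_pos hd1, div_le_iff₀ hd1]
    linarith
  have key (x : Hypercube d) : Real.cosh (a * kraw 2 x) - 1
      ≤ 200 * μ ^ 2 * Real.exp (total x ^ 2 / (4 * d)) := by
    set t := total x ^ 2 / d with ht
    have ht0 : 0 ≤ t := by positivity
    have h1 : a * kraw 2 x = μ * (t - 1) := by rw [kraw_two, hμ, ht]; field_simp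
    have h2 : total x ^ 2 / (4 * d) = t / 4 := by rw [ht]; field_simp
    have h3 : |t - 1| ≤ t + 1 := abs_le.2 ⟨by linarith, by linarith⟩
    rw [h1, h2]
    refine (Real.cosh_sub_one_le _).trans ?_
    -- The available exponent is t/4: one half pays for the polynomial factor, the other for exp
    -- |y|.
    have h4 : (t - 1) ^ 2 ≤ 128 * Real.exp ((t + 1) / 8) := by
      have := Real.pow_div_factorial_le_exp ((t + 1) / 8) (by positivity) 2
      norm_num [Nat.factorial] at this
      nlinarith
    have h5 : Real.exp |μ * (t - 1)| ≤ Real.exp ((t + 1) / 8) := by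
      rw [Real.exp_le_exp, abs_mul]
      nlinarith [abs_nonneg μ, abs_nonneg (t - 1)]
    have h6 : Real.exp ((t + 1) / 8) * Real.exp ((t + 1) / 8)
        = Real.exp (1 / 4) * Real.exp (t / 4) := by
      rw [← Real.exp_add, ← Real.exp_add]; ring_nf
    have h7 : Real.exp (1 / 4) ≤ 25 / 16 := by
      have h8 : Real.exp (1 / 4) ^ 4 = Real.exp 1 := by rw [← Real.exp_nat_mul]; norm_num
      by_contra! h9
      have h10 := pow_lt_pow_left₀ h9 (by norm_num) (n := 4) (by norm_num)
      rw [h8] at h10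
      norm_num at h10
      linarith [Real.exp_one_lt_d9]
    calc (μ * (t - 1)) ^ 2 * Real.exp |μ * (t - 1)|
        ≤ μ ^ 2 * (128 * Real.exp ((t + 1) / 8)) * Real.exp ((t + 1) / 8) := by
          rw [mul_pow]; gcongr
      _ = μ ^ 2 * 128 * (Real.exp (1 / 4) * Real.exp (t / 4)) := by rw [← h6]; ring
      _ ≤ μ ^ 2 * 128 * (25 / 16 * Real.exp (t / 4)) := by gcongr
      _ = _ := by ring
  refine (expect_le_expect fun x _ => key x).trans ?_
  rw [← mul_expect]
  nlinarith [expect_exp_total_sq_le_two (d := d) (by omega), sq_nonneg μ]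

lemma expect_cosh_kraw_three (hd : 6 ≤ d) {a : ℝ} (ha : |a| ≤ d / 16) :
    𝔼 x : Hypercube d, (Real.cosh (a * kraw 3 x) - 1) ≤ 100000 * a ^ 2 / d ^ 3 := by
  have hd' : (6 : ℝ) ≤ d := by exact_mod_cast hd
  have hd0 : (0 : ℝ) < d := by linarith
  have key (x : Hypercube d) : Real.cosh (a * kraw 3 x) - 1
      ≤ 36864 * a ^ 2 / d ^ 3 * Real.exp (total x ^ 2 / (4 * d)) := by
    set t := total x ^ 2 / d with ht
    have ht0 : 0 ≤ t := by positivity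
    have hs : total x ^ 2 = t * d := by rw [ht]; field_simp
    have hsd : |total x| ≤ d := abs_total_le x
    have h0 : total x ^ 2 / (4 * d) = t / 4 := by rw [ht]; field_simp
    have h1 : |kraw 3 x| ≤ 2 * |total x| * (t + 3) / d ^ 2 := by
      rw [kraw_three (by omega), abs_div,
        show total x ^ 3 - (3 * d - 2) * total x = total x * (t * d - (3 * d - 2)) by
          rw [← hs]; ring, abs_mul]
      have hpos : 0 < (d : ℝ) * (d - 1) * (d - 2) :=
        mul_pos (mul_pos hd0 (by linarith)) (by linarith)
      rw [abs_of_pos hpos, div_le_div_iff₀ hpos (by positivity)]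
      have e1 : |t * d - (3 * d - 2)| ≤ d * (t + 3) := by
        have : 0 ≤ t * d := by positivity
        exact abs_le.2 ⟨by linarith, by linarith⟩
      have e2 : (d : ℝ) ^ 2 * d ≤ 2 * (d * (d - 1) * (d - 2)) := by nlinarith
      calc |total x| * |t * d - (3 * d - 2)| * d ^ 2
          ≤ |total x| * (d * (t + 3)) * d ^ 2 := by gcongr
        _ = |total x| * (t + 3) * (d ^ 2 * d) := by ring
        _ ≤ |total x| * (t + 3) * (2 * (d * (d - 1) * (d - 2))) := by gcongr
        _ = _ := by ring
    -- The bound `h1` is kept for the square, where it yields d⁻³. In the exponent |total| ≤ d is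
    -- inserted instead, so that the exponent stays linear in t.
    have h2 : |kraw 3 x| ≤ 2 * (t + 3) / d := by
      refine h1.trans ?_
      rw [div_le_div_iff₀ (by positivity) hd0]
      calc 2 * |total x| * (t + 3) * d ≤ 2 * d * (t + 3) * d := by gcongr
        _ = _ := by ring
    have h3 : kraw 3 x ^ 2 ≤ 4 * (t + 3) ^ 3 / d ^ 3 := by
      rw [← sq_abs]
      calc |kraw 3 x| ^ 2 ≤ (2 * |total x| * (t + 3) / d ^ 2) ^ 2 := by gcongr
        _ = 4 * (t * (t + 3) ^ 2) / d ^ 3 := by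
          rw [div_pow, mul_pow, mul_pow, sq_abs, hs]; field_simp; ring
        _ ≤ _ := by
          gcongr
          nlinarith [sq_nonneg (t + 3)]
    have h4 : (t + 3) ^ 3 ≤ 3072 * Real.exp ((t + 3) / 8) := by
      have := Real.pow_div_factorial_le_exp ((t + 3) / 8) (by positivity) 3
      norm_num [Nat.factorial] at this
      nlinarith
    have h5 : |a * kraw 3 x| ≤ (t + 3) / 8 := by
      rw [abs_mul]
      calc |a| * |kraw 3 x| ≤ d / 16 * (2 * (t + 3) / d) := by gcongr
        _ = _ := by field_simp; norm_num
    have h6 : Real.exp ((t + 3) / 8) * Real.exp ((t + 3) / 8)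
        = Real.exp (3 / 4) * Real.exp (t / 4) := by
      rw [← Real.exp_add, ← Real.exp_add]; ring_nf
    have h7 : Real.exp (3 / 4) ≤ 3 := by
      have : Real.exp (3 / 4) ≤ Real.exp 1 := Real.exp_le_exp.2 (by norm_num)
      linarith [Real.exp_one_lt_d9]
    rw [h0]
    refine (Real.cosh_sub_one_le _).trans ?_
    calc (a * kraw 3 x) ^ 2 * Real.exp |a * kraw 3 x|
        ≤ a ^ 2 * (4 * (3072 * Real.exp ((t + 3) / 8)) / d ^ 3) * Real.exp ((t + 3) / 8) := by
          rw [mul_pow]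
          have := h3.trans (show 4 * (t + 3) ^ 3 / (d : ℝ) ^ 3
            ≤ 4 * (3072 * Real.exp ((t + 3) / 8)) / d ^ 3 by gcongr)
          gcongr
      _ = 12288 * a ^ 2 / d ^ 3 * (Real.exp (3 / 4) * Real.exp (t / 4)) := by rw [← h6]; ring
      _ ≤ 12288 * a ^ 2 / d ^ 3 * (3 * Real.exp (t / 4)) := by gcongr
      _ = _ := by ring
  refine (expect_le_expect fun x _ => key x).trans ?_
  rw [← mul_expect]
  have h1 := expect_exp_total_sq_le_two (d := d) (by omega)
  have h2 : 0 ≤ a ^ 2 / (d : ℝ) ^ 3 := by positivity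
  simp only [mul_div_assoc]
  nlinarith

/-- The middle levels are all dominated by a third level on a cube of at least half the
dimension. -/
lemma expect_cosh_kraw_mid {i : ℕ} (hd : 12 ≤ d) (hi : 3 ≤ i) (hi' : i + 3 ≤ d) {a : ℝ}
    (ha : |a| ≤ d / 32) :
    𝔼 x : Hypercube d, (Real.cosh (a * kraw i x) - 1) ≤ 800000 * a ^ 2 / d ^ 3 := by
  wlog h : 2 * i ≤ d generalizing i
  · have := this (i := d - i) (by omega) (by omega) (by omega)
    simpa only [cosh_kraw_sub (show i ≤ d by omega)] using this
  -- Descending k = i - 3 times reaches level 3 in dimension m = d - i + 3 ≥ d/2. The loss is the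
  -- factor 2³ = 8 in the constant.
  obtain ⟨k, rfl⟩ := Nat.exists_eq_add_of_le' hi
  obtain ⟨m, rfl⟩ : ∃ m, d = m + k := ⟨d - k, by omega⟩
  have hm : 6 ≤ m := by omega
  have hm0 : (6 : ℝ) ≤ m := by exact_mod_cast hm
  have hmk : ((m + k : ℕ) : ℝ) ≤ 2 * m := by exact_mod_cast (by omega : m + k ≤ 2 * m)
  have h1 := expect_cosh_kraw_add (d := m) (i := 3) (by omega) a k
  have h2 := expect_cosh_kraw_three hm (a := a) (by linarith)
  rw [expect_sub_distrib] at h2 ⊢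
  simp only [Fintype.expect_const] at h2 ⊢
  rw [add_comm k 3]
  refine (sub_le_sub_right h1 1).trans (h2.trans ?_)
  have h3 : (((m + k : ℕ) : ℝ)) ^ 3 ≤ (2 * m) ^ 3 := by gcongr
  have hmk0 : (0 : ℝ) < ((m + k : ℕ) : ℝ) := by exact_mod_cast (by omega)
  rw [div_le_div_iff₀ (by positivity) (by positivity)]
  nlinarith [mul_le_mul_of_nonneg_left h3 (sq_nonneg a)]

end Hypercube

namespace Hypercube

variable {d : ℕ}

/-! ### Fourier analysis of symmetric functions -/

/-- The common Fourier coefficient of degree `i` of a symmetric function. -/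
noncomputable def coeff (f : Hypercube d → ℝ) (i : ℕ) : ℝ := 𝔼 x, f x * kraw i x

/-- The Fourier weight of degree `i` of a symmetric function. -/
noncomputable def weight (f : Hypercube d → ℝ) (i : ℕ) : ℝ := d.choose i * coeff f i ^ 2

lemma weight_nonneg (f : Hypercube d → ℝ) (i : ℕ) : 0 ≤ weight f i := by
  unfold weight; positivity

lemma expect_mul_left (x : Hypercube d) (F : Hypercube d → ℝ) : 𝔼 z, F (x * z) = 𝔼 z, F z :=
  Fintype.expect_equiv (Equiv.mulLeft x) _ _ fun _ => rfl

lemma mul_self (x : Hypercube d) : x * x = 1 := by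
  ext j; simp

/-- The sum factors as ∏ (1 + z_j), which vanishes as soon as one coordinate is -1. -/
lemma sum_walsh (z : Hypercube d) : ∑ S, walsh S z = if z = 1 then 2 ^ d else 0 := by
  have h : ∑ S, walsh S z = ∏ j, (1 + coord z j) := by
    rw [Finset.prod_one_add, powerset_univ]; rfl
  rw [h]
  split_ifs with hz
  · subst hz; norm_num [coord]
  · obtain ⟨j, hj⟩ := Function.ne_iff.1 hz
    refine Finset.prod_eq_zero (mem_univ j) ?_
    rcases Int.units_eq_one_or (z j) with h | h
    · exact absurd h hj
    · simp [coord, h]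

/-- Parseval's identity on the hypercube. -/
lemma expect_mul_eq_sum (g h : Hypercube d → ℝ) :
    𝔼 z, g z * h z = ∑ S, (𝔼 z, g z * walsh S z) * 𝔼 z, h z * walsh S z := by
  have h1 (S : Finset (Fin d)) : (𝔼 z, g z * walsh S z) * 𝔼 z, h z * walsh S z
      = 𝔼 z, 𝔼 w, g z * h w * walsh S (z * w) := by
    rw [expect_mul_expect]
    refine expect_congr rfl fun z _ => expect_congr rfl fun w _ => ?_
    rw [walsh_mul]; ring
  simp_rw [h1, ← expect_sum_comm, ← mul_sum, sum_walsh]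
  refine expect_congr rfl fun z _ => ?_
  have h2 (w : Hypercube d) : z * w = 1 ↔ w = z := by
    rw [← mul_self z, mul_left_cancel_iff]
  simp_rw [h2]
  rw [Fintype.expect_eq_sum_div_card]
  simp

/-- Invariance of a real function on the hypercube under permutations of the coordinates. -/
def SymmFun (f : Hypercube d → ℝ) : Prop :=
  ∀ (π : Equiv.Perm (Fin d)) (x : Hypercube d), f (fun i => x (π i)) = f x

/-- Permutations act transitively on sets of a given size, so each coefficient equals the average
over its level. -/
lemma SymmFun.expect_mul_walsh {f : Hypercube d → ℝ} (hf : SymmFun f) (S : Finset (Fin d)) :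
    𝔼 x, f x * walsh S x = coeff f #S := by
  have h1 (T : Finset (Fin d)) (hT : #S = #T) : 𝔼 x, f x * walsh S x = 𝔼 x, f x * walsh T x := by
    obtain ⟨π, rfl⟩ := Equiv.Perm.exists_map_finset_eq S T hT
    symm
    refine Fintype.expect_equiv (π.symm.arrowCongr (Equiv.refl ℤˣ)) _ _ fun x => ?_
    rw [← hf π]
    simp [walsh, coord, Equiv.arrowCongr, Function.comp_def]
  have h2 : (0 : ℝ) < d.choose #S := by
    exact_mod_cast Nat.choose_pos (by simpa using card_le_univ S)
  have h3 : coeff f #S = (∑ T ∈ powersetCard #S univ, 𝔼 x, f x * walsh T x) / d.choose #S := by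
    rw [← expect_sum_comm, expect_div]
    refine expect_congr rfl fun x _ => ?_
    rw [kraw, esymm, ← mul_sum, mul_div_assoc]
  rw [h3, Finset.sum_congr rfl fun T hT => (h1 T (mem_powersetCard_univ.1 hT).symm).symm]
  simp [h2.ne']

/-- The autocorrelation of a symmetric function in terms of its weights. -/
lemma SymmFun.autocorrelation {f : Hypercube d → ℝ} (hf : SymmFun f) (x : Hypercube d) :
    𝔼 z, f (x * z) * f z = ∑ i ∈ range (d + 1), weight f i * kraw i x := by
  have h1 (S : Finset (Fin d)) :
      𝔼 z, f (x * z) * walsh S z = walsh S x * coeff f #S := by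
    rw [← hf.expect_mul_walsh, mul_expect, ← expect_mul_left x]
    refine expect_congr rfl fun z _ => ?_
    rw [← mul_assoc, mul_self, one_mul, walsh_mul]; ring
  rw [expect_mul_eq_sum]
  simp_rw [h1, hf.expect_mul_walsh]
  rw [← powerset_univ, sum_powerset, card_univ, Fintype.card_fin]
  refine Finset.sum_congr rfl fun i hi => ?_
  have h2 : (0 : ℝ) < d.choose i := by
    exact_mod_cast Nat.choose_pos (by simpa [Nat.lt_succ_iff] using hi)
  have h3 : weight f i * kraw i x = coeff f i ^ 2 * esymm i x := by
    rw [weight, kraw]; field_simp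
  rw [h3, esymm, mul_sum]
  refine Finset.sum_congr rfl fun S hS => ?_
  rw [mem_powersetCard_univ.1 hS]; ring

lemma kraw_zero (x : Hypercube d) : kraw 0 x = 1 := by simp [kraw, esymm_zero]

lemma weight_zero (f : Hypercube d → ℝ) : weight f 0 = (𝔼 x, f x) ^ 2 := by
  simp [weight, coeff, kraw_zero]

/-- Twisting by parity preserves |f|, so the level inequalities for the twisted function control
levels d - 1 and d - 2. -/
lemma weight_sub (f : Hypercube d → ℝ) {i : ℕ} (hi : i ≤ d) :
    weight f (d - i) = weight (fun x => f x * walsh univ x) i := by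
  rw [weight, weight, Nat.choose_symm hi, coeff, coeff]
  simp_rw [kraw_sub hi, mul_assoc]

lemma kraw_neg (i : ℕ) (x : Hypercube d) : kraw i (-x) = (-1) ^ i * kraw i x := by
  rw [kraw, kraw, ← mul_div_assoc, esymm, esymm, mul_sum]
  congr 1
  refine Finset.sum_congr rfl fun S hS => ?_
  rw [← mem_powersetCard_univ.1 hS]
  simp [walsh, coord, Finset.prod_neg]

lemma weight_eq_zero_of_odd {f : Hypercube d → ℝ} (hf : ∀ x, f (-x) = f x) {i : ℕ}
    (hi : Odd i) : weight f i = 0 := by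
  have h : coeff f i = -coeff f i := by
    conv_lhs => rw [coeff, ← Fintype.expect_equiv (Equiv.neg _) (fun x => f (-x) * kraw i (-x)) _
      (fun _ => rfl)]
    simp_rw [hf, kraw_neg, hi.neg_one_pow, coeff, ← expect_neg_distrib]
    exact expect_congr rfl fun x _ => by ring
  have : coeff f i = 0 := by linarith
  simp [weight, this]

/-! ### Level inequalities -/

/-- The entropy inequality: a density of mass q cannot concentrate where total²/d is much larger
than log(2/q), because that variable has an exponential moment. -/
lemma expect_abs_mul_total_sq_le (hd : 0 < d) {f : Hypercube d → ℝ} {q : ℝ} (hq : 0 < q)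
    (hf : ∀ x, |f x| ≤ 1) (hfq : 𝔼 x, |f x| = q) :
    𝔼 x, |f x| * (total x ^ 2 / d) ≤ 4 * q * Real.log (2 / q) := by
  set c := Real.log (2 / q)
  have hc : Real.exp (-c) = q / 2 := by
    rw [Real.exp_neg, Real.exp_log (by positivity), inv_div]
  have key (x : Hypercube d) : |f x| * (total x ^ 2 / d)
      ≤ 2 * q * Real.exp (total x ^ 2 / (4 * d)) + 4 * (c - 1) * |f x| := by
    -- The tangent is taken at c, where e^{-c} = q/2, so that after averaging the exponential term
    -- contributes 4q and cancels the -4q.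
    have h1 := Real.add_one_le_exp (total x ^ 2 / (4 * d) + -c)
    rw [Real.exp_add, hc] at h1
    have h2 : total x ^ 2 / d = 4 * (total x ^ 2 / (4 * d)) := by
      rw [← div_div]; ring
    have h3 := Real.exp_pos (total x ^ 2 / (4 * d))
    set E := Real.exp (total x ^ 2 / (4 * d))
    have h4 : |f x| * (E * (q / 2)) ≤ 1 * (E * (q / 2)) := by
      gcongr; exact hf x
    rw [h2]
    nlinarith [mul_le_mul_of_nonneg_left h1 (abs_nonneg (f x))]
  refine (expect_le_expect fun x _ => key x).trans ?_
  rw [expect_add_distrib, ← mul_expect, ← mul_expect, hfq]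
  nlinarith [expect_exp_total_sq_le_two hd]

/-- Level-1 inequality. -/
lemma weight_one_le (hd : 0 < d) {f : Hypercube d → ℝ} {q : ℝ} (hq : 0 < q)
    (hf : ∀ x, |f x| ≤ 1) (hfq : 𝔼 x, |f x| = q) :
    weight f 1 ≤ 4 * q ^ 2 * Real.log (2 / q) := by
  have hd' : (0 : ℝ) < d := by exact_mod_cast hd
  have h1 := expect_abs_mul_total_sq_le hd hq hf hfq
  set A := 𝔼 x, |f x| * (total x ^ 2 / d) with hA
  set B := 𝔼 x, |f x| * |total x| with hB
  have hB0 : 0 ≤ B := expect_nonneg fun x _ => by positivity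
  -- Cauchy–Schwarz for the weight |f|, read off from the nonnegative quadratic with the factor q
  -- cleared.
  have hBA : B ^ 2 ≤ q * (d * A) := by
    have h2 : 0 ≤ 𝔼 x, |f x| * (q * |total x| - B) ^ 2 :=
      expect_nonneg fun x _ => by positivity
    have h3 : 𝔼 x, |f x| * (q * |total x| - B) ^ 2
        = q ^ 2 * (d * A) - 2 * q * B * B + B ^ 2 * q := by
      have e (x : Hypercube d) : |f x| * (q * |total x| - B) ^ 2
          = q ^ 2 * d * (|f x| * (total x ^ 2 / d)) - 2 * q * B * (|f x| * |total x|)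
            + B ^ 2 * |f x| := by
        rw [← sq_abs (total x)]; field_simp; ring
      simp_rw [e]
      rw [expect_add_distrib, expect_sub_distrib, ← mul_expect, ← mul_expect, ← mul_expect, hfq,
        ← hA, ← hB]
      ring
    nlinarith
  have h4 : |coeff f 1| ≤ B / d := by
    rw [coeff, hB, expect_div]
    refine (abs_expect_le _ _).trans (expect_le_expect fun x _ => ?_)
    rw [kraw_one, abs_mul, abs_div, Nat.abs_cast, mul_div_assoc]
  have h5 : coeff f 1 ^ 2 ≤ (B / d) ^ 2 := by
    rw [← sq_abs]; gcongr
  calc weight f 1 = d * coeff f 1 ^ 2 := by simp [weight]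
    _ ≤ d * (B / d) ^ 2 := by gcongr
    _ = B ^ 2 / d := by field_simp
    _ ≤ q * (d * A) / d := by gcongr
    _ = q * A := by field_simp
    _ ≤ q * (4 * q * Real.log (2 / q)) := by gcongr
    _ = _ := by ring

/-- Level-2 inequality. -/
lemma weight_two_le (hd : 2 ≤ d) {f : Hypercube d → ℝ} {q : ℝ} (hq : 0 < q)
    (hf : ∀ x, |f x| ≤ 1) (hfq : 𝔼 x, |f x| = q) :
    weight f 2 ≤ (q * (4 * Real.log (2 / q) + 1)) ^ 2 := by
  have hd' : (2 : ℝ) ≤ d := by exact_mod_cast hd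
  have hd1 : (0 : ℝ) < d - 1 := by linarith
  have h1 := expect_abs_mul_total_sq_le (by omega) hq hf hfq
  set B := q * (4 * Real.log (2 / q) + 1) with hB
  have h4 : |coeff f 2| ≤ B / (d - 1) := by
    rw [coeff]
    refine (abs_expect_le _ _).trans ?_
    calc 𝔼 x, |f x * kraw 2 x| ≤ 𝔼 x, (|f x| * (total x ^ 2 / d) + |f x|) / (d - 1) := by
          refine expect_le_expect fun x _ => ?_
          have e1 : kraw 2 x = (total x ^ 2 / d - 1) / (d - 1) := by
            rw [kraw_two]; field_simp
          rw [abs_mul, e1, abs_div, abs_of_pos hd1, mul_div_assoc', ← mul_add_one]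
          gcongr
          have : 0 ≤ total x ^ 2 / d := by positivity
          exact abs_le.2 ⟨by linarith, by linarith⟩
      _ ≤ B / (d - 1) := by
          rw [← expect_div, expect_add_distrib, hfq]
          gcongr
          linarith
  have h5 : coeff f 2 ^ 2 ≤ (B / (d - 1)) ^ 2 := by
    rw [← sq_abs]; gcongr
  calc weight f 2 = d * (d - 1) / 2 * coeff f 2 ^ 2 := by rw [weight, Nat.cast_choose_two]
    _ ≤ d * (d - 1) / 2 * (B / (d - 1)) ^ 2 := by gcongr
    _ = B ^ 2 * (d / (2 * (d - 1))) := by field_simp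
    _ ≤ B ^ 2 * 1 := by
        gcongr
        rw [div_le_one (by linarith)]
        linarith
    _ = _ := mul_one _

end Hypercube

/-! ### Binomial coefficients and the top Fourier weight -/

lemma Nat.two_mul_add_one_mul_centralBinom_sq_le (n : ℕ) :
    (2 * n + 1) * n.centralBinom ^ 2 ≤ 16 ^ n := by
  induction n with
  | zero => simp
  | succ n ih =>
    have h := Nat.succ_mul_centralBinom_succ n
    have h1 : (n + 1) ^ 2 * ((2 * (n + 1) + 1) * (n + 1).centralBinom ^ 2)
        ≤ (n + 1) ^ 2 * 16 ^ (n + 1) := by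
      calc (n + 1) ^ 2 * ((2 * (n + 1) + 1) * (n + 1).centralBinom ^ 2)
          = (2 * (n + 1) + 1) * ((n + 1) * (n + 1).centralBinom) ^ 2 := by ring
        _ = (4 * (2 * n + 1) * (2 * n + 3)) * ((2 * n + 1) * n.centralBinom ^ 2) := by
          rw [h]; ring
        -- The ratio is controlled by (2n + 1)(2n + 3) ≤ (2n + 2)².
        _ ≤ (16 * (n + 1) ^ 2) * 16 ^ n := by
          exact Nat.mul_le_mul (by nlinarith) ih
        _ = _ := by ring
    exact Nat.le_of_mul_le_mul_left h1 (by positivity)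

/-- Every point mass of the binomial(m, 1/2) law is thus at most √(2/(m + 1)). Odd rows reduce to
even ones by Pascal's rule. -/
lemma Nat.add_one_mul_choose_sq_le (m k : ℕ) : (m + 1) * m.choose k ^ 2 ≤ 2 * 4 ^ m := by
  rcases Nat.even_or_odd' m with ⟨r, rfl | rfl⟩
  · have h1 := Nat.two_mul_add_one_mul_centralBinom_sq_le r
    have h2 := Nat.choose_le_centralBinom k r
    calc (2 * r + 1) * (2 * r).choose k ^ 2 ≤ (2 * r + 1) * r.centralBinom ^ 2 := by gcongr
      _ ≤ 16 ^ r := h1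
      _ ≤ 2 * 4 ^ (2 * r) := by rw [pow_mul]; norm_num
  · have h1 := Nat.two_mul_add_one_mul_centralBinom_sq_le r
    have h2 : (2 * r + 1).choose k ≤ 2 * r.centralBinom := by
      cases k with
      | zero => have := Nat.centralBinom_pos r; simp; omega
      | succ k =>
        rw [Nat.choose_succ_succ]
        have h3 := Nat.choose_le_centralBinom k r
        have h4 := Nat.choose_le_centralBinom (k + 1) r
        simp only [Nat.succ_eq_add_one]
        omega
    calc (2 * r + 1 + 1) * (2 * r + 1).choose k ^ 2
        ≤ (2 * r + 1 + 1) * (2 * r.centralBinom) ^ 2 := by gcongr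
      _ ≤ 8 * ((2 * r + 1) * r.centralBinom ^ 2) := by
        have := sq_nonneg r.centralBinom
        nlinarith
      _ ≤ 8 * 16 ^ r := by gcongr
      _ = 2 * 4 ^ (2 * r + 1) := by rw [pow_succ, pow_mul]; ring

namespace Hypercube

variable {d : ℕ}

/-- The number of coordinates equal to `1`. -/
def ones (x : Hypercube d) : ℕ := #{k | x k = 1}

lemma SymmFun.apply_eq_levelPoint {f : Hypercube d → ℝ} (hf : SymmFun f) (x : Hypercube d) :
    f x = f (Connection.levelPoint d (ones x)) := by
  have h : #{k | x k = 1} = #{k : Fin d | (k : ℕ) < ones x} := by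
    rw [Fin.card_filter_val_lt]
    have : ones x ≤ d := by simpa [ones] using card_le_univ {k | x k = 1}
    exact (min_eq_right this).symm
  obtain ⟨π, hπ⟩ := Equiv.Perm.exists_map_finset_eq _ _ h
  rw [← hf π (Connection.levelPoint d (ones x))]
  congr 1
  ext k
  have h1 : x k = 1 ↔ ((π k : Fin d) : ℕ) < ones x := by
    have := congrArg (fun A => π k ∈ A) hπ
    simpa using this
  rcases Int.units_eq_one_or (x k) with h2 | h2
  · simp [Connection.levelPoint, h2, h1.1 h2]
  · have h3 : ¬ ((π k : Fin d) : ℕ) < ones x := by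
      rw [← h1, h2]; decide
    simp [Connection.levelPoint, h2, h3]

lemma expect_ones (F : ℕ → ℝ) :
    𝔼 x : Hypercube d, F (ones x) = (∑ k ∈ range (d + 1), d.choose k * F k) / 2 ^ d := by
  rw [Fintype.expect_eq_sum_div_card, card_eq]
  congr 1
  have h : ∑ x : Hypercube d, F (ones x) = ∑ S : Finset (Fin d), F #S := by
    refine Finset.sum_nbij' (fun x => ({k | x k = 1} : Finset (Fin d)))
      (fun S k => if k ∈ S then 1 else -1) (by simp) (by simp) ?_ ?_ (fun x _ => rfl)
    · intro x _
      ext k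
      rcases Int.units_eq_one_or (x k) with h2 | h2 <;> simp [h2]
    · intro S _
      ext k
      by_cases h : k ∈ S <;> simp [h]
  rw [h, ← powerset_univ, sum_powerset_apply_card]
  simp

lemma ones_insertNth (u : ℤˣ) (y : Hypercube d) :
    ones ((0 : Fin (d + 1)).insertNth (α := fun _ => ℤˣ) u y : Hypercube (d + 1))
      = (if u = 1 then 1 else 0) + ones y := by
  simp only [ones, card_filter, Fin.sum_univ_succAbove _ 0]
  simp

/-- The top Fourier weight is controlled by the fluctuation. -/
lemma weight_top_le (hd : 0 < d) (σ : Connection d) (hσ : SymmFun fun x => (σ x : ℝ)) :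
    weight (fun x => (σ x : ℝ)) d ≤ σ.fluctuation ^ 2 / (2 * d) := by
  cases d with
  | zero => omega
  | succ m =>
  set f : Hypercube (m + 1) → ℝ := fun x => (σ x : ℝ) with hf
  set g : ℕ → ℝ := fun k => f (Connection.levelPoint (m + 1) k) with hg
  have hk (x : Hypercube (m + 1)) : kraw (m + 1) x = walsh univ x := by
    simpa [kraw_zero] using kraw_sub (Nat.zero_le (m + 1)) x
  have hw (u : ℤˣ) (y : Hypercube m) :
      walsh univ ((0 : Fin (m + 1)).insertNth (α := fun _ => ℤˣ) u y : Hypercube (m + 1))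
        = ((u : ℤ) : ℝ) * walsh univ y := by
    simp [walsh, coord, Fin.prod_univ_succAbove _ 0]
  have hfg (u : ℤˣ) (y : Hypercube m) :
      f ((0 : Fin (m + 1)).insertNth (α := fun _ => ℤˣ) u y : Hypercube (m + 1))
        = g ((if u = 1 then 1 else 0) + ones y) := by
    rw [hσ.apply_eq_levelPoint, ones_insertNth]
  -- Averaging over coordinate 0 first, the parity changes sign between its two values and leaves a
  -- discrete derivative of the level values.
  have h1 : |coeff f (m + 1)| ≤ 𝔼 y : Hypercube m, |g (ones y + 1) - g (ones y)| / 2 := by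
    rw [coeff, expect_insertNth 0]
    refine (abs_expect_le _ _).trans (expect_le_expect fun y _ => ?_)
    rw [hk, hk, hw, hw, hfg, hfg, if_pos rfl, if_neg (by decide), zero_add, add_comm 1]
    rw [abs_div, show g (ones y + 1) * ((((1 : ℤˣ) : ℤ) : ℝ) * walsh univ y)
      + g (ones y) * ((((-1 : ℤˣ) : ℤ) : ℝ) * walsh univ y)
      = (g (ones y + 1) - g (ones y)) * walsh univ y by push_cast; ring, abs_mul, abs_walsh]
    simp
  rw [expect_ones fun k => |g (k + 1) - g k| / 2] at h1
  set M : ℝ := Real.sqrt (2 * 4 ^ m / (m + 1)) with hM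
  have hM2 : M ^ 2 = 2 * 4 ^ m / (m + 1) := Real.sq_sqrt (by positivity)
  have hMk (k : ℕ) : (m.choose k : ℝ) ≤ M := by
    refine Real.le_sqrt_of_sq_le ?_
    rw [le_div_iff₀ (by positivity), mul_comm]
    exact_mod_cast Nat.add_one_mul_choose_sq_le m k
  have h2 : |coeff f (m + 1)| ≤ M * σ.fluctuation / 2 / 2 ^ m := by
    refine h1.trans (div_le_div_of_nonneg_right ?_ (by positivity))
    rw [Connection.fluctuation, mul_div_assoc, Finset.sum_div, mul_sum]
    gcongr with k
    exact hMk k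
  have h3 : coeff f (m + 1) ^ 2 ≤ (M * σ.fluctuation / 2 / 2 ^ m) ^ 2 := by
    rw [← sq_abs]; gcongr
  have h4 : ((2 : ℝ) ^ m) ^ 2 = 4 ^ m := by rw [← pow_mul, mul_comm, pow_mul]; norm_num
  calc weight f (m + 1) = coeff f (m + 1) ^ 2 := by simp [weight]
    _ ≤ (M * σ.fluctuation / 2 / 2 ^ m) ^ 2 := h3
    _ = _ := by
      rw [div_pow, div_pow, mul_pow, hM2, h4]
      push_cast
      field_simp

end Hypercube

/-! ### Chain rule for mixtures -/

/-- One step of the chain rule for the divergence of a mixture from a product law. -/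
lemma sum_mul_log_le_of_mixture {Ω A B : Type*} [Fintype Ω] [Nonempty Ω] [Fintype A] [Fintype B]
    (f : Ω → A → ℝ) (h : Ω → B → ℝ) (Q : A → ℝ) (q : B → ℝ)
    (hf0 : ∀ ω a, 0 ≤ f ω a) (hf1 : ∀ ω, ∑ a, f ω a = 1)
    (hh0 : ∀ ω b, 0 ≤ h ω b) (hh1 : ∀ ω, ∑ b, h ω b = 1)
    (hQ : ∀ a, 0 < Q a) (hq : ∀ b, 0 < q b) (hq1 : ∑ b, q b = 1) :
    ∑ a, ∑ b, (𝔼 ω, f ω a * h ω b) * Real.log ((𝔼 ω, f ω a * h ω b) / (Q a * q b))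
      ≤ ∑ a, (𝔼 ω, f ω a) * Real.log ((𝔼 ω, f ω a) / Q a)
        + Real.log (𝔼 ω, ∑ b, h ω b ^ 2 / q b) := by
  set C := 𝔼 ω, ∑ b, h ω b ^ 2 / q b with hC
  set P : A → ℝ := fun a => 𝔼 ω, f ω a with hP
  set R : A → B → ℝ := fun a b => 𝔼 ω, f ω a * h ω b with hR
  have hP0 (a : A) : 0 ≤ P a := expect_nonneg fun ω _ => hf0 ω a
  have hR0 (a : A) (b : B) : 0 ≤ R a b :=
    expect_nonneg fun ω _ => mul_nonneg (hf0 ω a) (hh0 ω b)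
  have hRP (a : A) : ∑ b, R a b = P a := by
    simp only [hR, hP]
    rw [← expect_sum_comm]
    refine expect_congr rfl fun ω _ => ?_
    rw [← mul_sum, hh1, mul_one]
  have hP1 : ∑ a, P a = 1 := by
    simp only [hP]
    rw [← expect_sum_comm]
    simp [hf1]
  have hC1 : 1 ≤ C := by
    refine le_expect univ_nonempty fun ω _ => ?_
    calc (1 : ℝ) = ∑ b, (2 * h ω b - q b) := by
          rw [Finset.sum_sub_distrib, ← mul_sum, hh1, hq1]; norm_num
      _ ≤ _ := by
          refine Finset.sum_le_sum fun b _ => ?_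
          rw [le_div_iff₀ (hq b)]
          nlinarith [sq_nonneg (h ω b - q b)]
  have hC0 : 0 < C := by linarith
  -- Conditional Cauchy–Schwarz, from the variance of h under the weights f/P; where P vanishes the
  -- quotient is 0 by convention.
  have hCS (a : A) (b : B) : R a b ^ 2 / P a ≤ 𝔼 ω, f ω a * h ω b ^ 2 := by
    have h1 : 0 ≤ 𝔼 ω, f ω a * (h ω b - R a b / P a) ^ 2 :=
      expect_nonneg fun ω _ => mul_nonneg (hf0 ω a) (sq_nonneg _)
    have h2 : 𝔼 ω, f ω a * (h ω b - R a b / P a) ^ 2 = 𝔼 ω, f ω a * h ω b ^ 2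
        - 2 * (R a b / P a) * R a b + (R a b / P a) ^ 2 * P a := by
      have e (ω : Ω) : f ω a * (h ω b - R a b / P a) ^ 2 = f ω a * h ω b ^ 2
          - 2 * (R a b / P a) * (f ω a * h ω b) + (R a b / P a) ^ 2 * f ω a := by ring
      simp_rw [e]
      rw [expect_add_distrib, expect_sub_distrib, ← mul_expect, ← mul_expect]
    rcases eq_or_ne (P a) 0 with h0 | h0
    · rw [h0, div_zero]
      exact expect_nonneg fun ω _ => mul_nonneg (hf0 ω a) (sq_nonneg _)
    · have h3 : 2 * (R a b / P a) * R a b = 2 * (R a b ^ 2 / P a) := by ring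
      have h4 : (R a b / P a) ^ 2 * P a = R a b ^ 2 / P a := by field_simp
      rw [h2, h3, h4] at h1
      linarith
  have hpt (a : A) (b : B) : R a b * Real.log (R a b / (Q a * q b))
      ≤ R a b * Real.log (P a / Q a) + (𝔼 ω, f ω a * h ω b ^ 2) / q b / C
        + R a b * (Real.log C - 1) := by
    have hnn : 0 ≤ (𝔼 ω, f ω a * h ω b ^ 2) / q b / C :=
      div_nonneg (div_nonneg (expect_nonneg fun ω _ => mul_nonneg (hf0 ω a) (sq_nonneg _))
        (hq b).le) hC0.le
    rcases (hR0 a b).eq_or_lt with h0 | h0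
    · rw [← h0]; simpa using hnn
    have hPpos : 0 < P a := by
      refine (hP0 a).lt_of_ne fun h1 => h0.ne' ?_
      rw [← hRP a] at h1
      exact (Finset.sum_eq_zero_iff_of_nonneg fun b _ => hR0 a b).1 h1.symm b (mem_univ b)
    have hr : 0 < R a b / (P a * q b) := div_pos h0 (mul_pos hPpos (hq b))
    have h1 : R a b / (Q a * q b) = P a / Q a * (R a b / (P a * q b)) := by
      have := (hQ a).ne'; have := (hq b).ne'; have := hPpos.ne'
      field_simp
    -- The tangent to log at C, the bound on the mean of the ratio. The linear terms then sum to at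
    -- most 1, cancel the -1, and leave log C, as in Jensen.
    have h2 : Real.log (R a b / (P a * q b)) ≤ R a b / (P a * q b) / C - 1 + Real.log C := by
      have := Real.log_le_sub_one_of_pos (div_pos hr hC0)
      rw [Real.log_div hr.ne' hC0.ne'] at this
      linarith
    have h3 : R a b * (R a b / (P a * q b) / C) ≤ (𝔼 ω, f ω a * h ω b ^ 2) / q b / C := by
      have e : R a b * (R a b / (P a * q b) / C) = R a b ^ 2 / P a / q b / C := by
        field_simp
      rw [e]
      have := (hq b).le
      gcongr
      exact hCS a b
    rw [h1, Real.log_mul (div_pos hPpos (hQ a)).ne' hr.ne']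
    nlinarith [mul_le_mul_of_nonneg_left h2 h0.le]
  have hsum : ∑ a, ∑ b, (𝔼 ω, f ω a * h ω b ^ 2) / q b / C = 1 := by
    have h1 : ∑ a, ∑ b, (𝔼 ω, f ω a * h ω b ^ 2) / q b = C := by
      simp_rw [expect_div]
      rw [Finset.sum_comm]
      simp_rw [← expect_sum_comm]
      rw [hC]
      refine expect_congr rfl fun ω _ => Finset.sum_congr rfl fun b _ => ?_
      rw [← Finset.sum_div, ← Finset.sum_mul, hf1, one_mul]
    simp_rw [← Finset.sum_div]
    rw [h1, div_self hC0.ne']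
  calc ∑ a, ∑ b, R a b * Real.log (R a b / (Q a * q b))
      ≤ ∑ a, ∑ b, (R a b * Real.log (P a / Q a) + (𝔼 ω, f ω a * h ω b ^ 2) / q b / C
        + R a b * (Real.log C - 1)) :=
        Finset.sum_le_sum fun a _ => Finset.sum_le_sum fun b _ => hpt a b
    _ = ∑ a, P a * Real.log (P a / Q a) + Real.log C := by
        simp_rw [Finset.sum_add_distrib, hsum, ← Finset.sum_mul, hRP, hP1]
        ring

/-! ### Adding a vertex to a graph -/

namespace SimpleGraph

variable {n : ℕ}

/-- The graph on `Fin (n + 1)` extending `H` in which `Fin.last n` is joined to the vertices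
selected by `b`. -/
def addLast (H : SimpleGraph (Fin n)) (b : Fin n → Bool) : SimpleGraph (Fin (n + 1)) :=
  SimpleGraph.fromRel fun u v => (∃ i j, u = Fin.castSucc i ∧ v = Fin.castSucc j ∧ H.Adj i j) ∨
    ∃ i, u = Fin.castSucc i ∧ v = Fin.last n ∧ b i = true

@[simp]
lemma addLast_adj_castSucc (H : SimpleGraph (Fin n)) (b : Fin n → Bool) (i j : Fin n) :
    (H.addLast b).Adj i.castSucc j.castSucc ↔ H.Adj i j := by
  have h (k : Fin n) : Fin.castSucc k ≠ Fin.last n := (Fin.castSucc_lt_last k).ne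
  simp only [addLast, SimpleGraph.fromRel_adj, Fin.castSucc_inj, h, false_and, and_false,
    exists_false, or_false, ne_eq]
  constructor
  · rintro ⟨-, ⟨i', j', rfl, rfl, h⟩ | ⟨i', j', rfl, rfl, h⟩⟩
    · exact h
    · exact h.symm
  · exact fun h => ⟨h.ne, Or.inl ⟨i, j, rfl, rfl, h⟩⟩

@[simp]
lemma addLast_adj_last (H : SimpleGraph (Fin n)) (b : Fin n → Bool) (i : Fin n) :
    (H.addLast b).Adj i.castSucc (Fin.last n) ↔ b i = true := by
  have h (k : Fin n) : Fin.castSucc k ≠ Fin.last n := (Fin.castSucc_lt_last k).ne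
  simp [addLast, h, fun k => (h k).symm]

open Classical in
/-- A graph on `Fin (n + 1)` is a graph on `Fin n` with the neighbours of the last vertex. -/
noncomputable def addLastEquiv (n : ℕ) :
    SimpleGraph (Fin n) × (Fin n → Bool) ≃ SimpleGraph (Fin (n + 1)) where
  toFun q := q.1.addLast q.2
  invFun G := (G.comap Fin.castSucc, fun i => decide (G.Adj i.castSucc (Fin.last n)))
  left_inv q := by
    ext <;> simp
  right_inv G := by
    ext u v
    induction u using Fin.lastCases with
    | last =>
      induction v using Fin.lastCases with
      | last => simp
      | cast j => rw [SimpleGraph.adj_comm, G.adj_comm]; simp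
    | cast i =>
      induction v using Fin.lastCases with
      | last => simp
      | cast j => simp

open Classical in
/-- The probability of `G` when the pairs `i < j` are joined independently with
probabilities `W i j`. -/
noncomputable def edgeProd (W : Fin n → Fin n → ℝ) (G : SimpleGraph (Fin n)) : ℝ :=
  ∏ e ∈ Finset.univ.filter (fun e : Fin n × Fin n => e.1 < e.2),
    if G.Adj e.1 e.2 then W e.1 e.2 else 1 - W e.1 e.2

lemma edgeProd_addLast (W : Fin (n + 1) → Fin (n + 1) → ℝ) (H : SimpleGraph (Fin n))
    (b : Fin n → Bool) :
    (H.addLast b).edgeProd W = H.edgeProd (fun i j => W i.castSucc j.castSucc) *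
      ∏ i, (if b i then W i.castSucc (Fin.last n) else 1 - W i.castSucc (Fin.last n)) := by
  classical
  simp only [edgeProd, Finset.prod_filter, Fintype.prod_prod_type, Fin.prod_univ_castSucc]
  have h (i : Fin n) : ¬ Fin.last n < i.castSucc := (Fin.castSucc_lt_last i).not_gt
  simp only [Fin.castSucc_lt_castSucc_iff, addLast_adj_castSucc, Fin.castSucc_lt_last,
    addLast_adj_last, if_true, h, lt_irrefl, if_false, Finset.prod_const_one, mul_one,
    Finset.prod_mul_distrib]

lemma edgeProd_nonneg {W : Fin n → Fin n → ℝ} (h0 : ∀ i j, 0 ≤ W i j) (h1 : ∀ i j, W i j ≤ 1)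
    (G : SimpleGraph (Fin n)) : 0 ≤ G.edgeProd W := by
  refine Finset.prod_nonneg fun e _ => ?_
  split_ifs
  · exact h0 _ _
  · linarith [h1 e.1 e.2]

lemma edgeProd_pos {W : Fin n → Fin n → ℝ} (h0 : ∀ i j, 0 < W i j) (h1 : ∀ i j, W i j < 1)
    (G : SimpleGraph (Fin n)) : 0 < G.edgeProd W := by
  refine Finset.prod_pos fun e _ => ?_
  split_ifs
  · exact h0 _ _
  · linarith [h1 e.1 e.2]

lemma sum_prod_bernoulli (w : Fin n → ℝ) :
    ∑ b : Fin n → Bool, ∏ i, (if b i then w i else 1 - w i) = 1 := by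
  rw [← Fintype.prod_sum fun i (c : Bool) => if c then w i else 1 - w i]
  simp

lemma sum_eq_sum_addLast (F : SimpleGraph (Fin (n + 1)) → ℝ) :
    ∑ G, F G = ∑ H, ∑ b, F (addLast H b) := by
  rw [← Fintype.sum_prod_type' fun H b => F (addLast H b)]
  exact (Fintype.sum_equiv (addLastEquiv n) _ _ fun _ => rfl).symm

lemma sum_edgeProd : ∀ {n : ℕ} (W : Fin n → Fin n → ℝ), ∑ G, edgeProd W G = 1
  | 0, W => by
    rw [Fintype.sum_eq_single (⊥ : SimpleGraph (Fin 0)) fun G h => (h (Subsingleton.elim _ _)).elim]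
    simp [edgeProd]
  | n + 1, W => by
    rw [sum_eq_sum_addLast]
    simp_rw [edgeProd_addLast, ← mul_sum, sum_prod_bernoulli, mul_one]
    exact sum_edgeProd _

end SimpleGraph

/-! ### Second moments and the autocorrelation -/

namespace Connection

open SimpleGraph

variable {d n : ℕ}

/-- The normalized autocorrelation of `σ - p`, where `p` is the mean of `σ`. -/
noncomputable def corr (σ : Connection d) (p : ℝ) (u : Hypercube d) : ℝ :=
  ((𝔼 z, (σ (u * z) : ℝ) * σ z) - p ^ 2) / (p * (1 - p))

lemma mean_eq_expect (σ : Connection d) : (σ.mean : ℝ) = 𝔼 x, (σ x : ℝ) := by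
  rw [Fintype.expect_eq_sum_div_card]; rfl

/-- The contribution of one potential edge to the second moment. Translating y by z' shows that only
the product z z' matters. -/
lemma expect_bernoulli_mul (σ : Connection d) {p : ℝ} (hp : p = σ.mean) (hp0 : 0 < p)
    (hp1 : p < 1) (z z' : Hypercube d) :
    𝔼 y, ∑ c : Bool, (if c then (σ (y * z) : ℝ) else 1 - σ (y * z)) *
      (if c then (σ (y * z') : ℝ) else 1 - σ (y * z')) / (if c then p else 1 - p)
      = 1 + corr σ p (z * z') := by
  have hm (z : Hypercube d) : 𝔼 y, (σ (y * z) : ℝ) = p := by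
    rw [hp, mean_eq_expect]
    exact Fintype.expect_equiv (Equiv.mulRight z) _ _ fun _ => rfl
  have hA : 𝔼 y, (σ (y * z) : ℝ) * σ (y * z') = 𝔼 y, (σ ((z * z') * y) : ℝ) * σ y := by
    refine Fintype.expect_equiv (Equiv.mulRight z') _ _ fun y => ?_
    have : z * z' * (y * z') = y * z := by
      rw [mul_comm y z', ← mul_assoc, mul_assoc z, Hypercube.mul_self, mul_one, mul_comm]
    simp only [Equiv.coe_mulRight, this]
  have e (y : Hypercube d) : ∑ c : Bool, (if c then (σ (y * z) : ℝ) else 1 - σ (y * z)) *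
      (if c then (σ (y * z') : ℝ) else 1 - σ (y * z')) / (if c then p else 1 - p)
      = (1 / p + 1 / (1 - p)) * ((σ (y * z) : ℝ) * σ (y * z')) + 1 / (1 - p)
        - (1 / (1 - p)) * (σ (y * z) + σ (y * z')) := by
    simp; ring
  simp_rw [e]
  rw [expect_sub_distrib, expect_add_distrib, ← mul_expect, ← mul_expect, expect_add_distrib, hm,
    hm, Fintype.expect_const, hA, corr]
  have : 1 - p ≠ 0 := by linarith
  field_simp
  ring

/-- The chi-square term of one vertex. -/
lemma expect_chiSq (σ : Connection d) {p : ℝ} (hp : p = σ.mean) (hp0 : 0 < p) (hp1 : p < 1) :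
    𝔼 x : Fin n → Hypercube d, ∑ b : Fin n → Bool,
      (𝔼 z, ∏ i, (if b i then (σ (x i * z) : ℝ) else 1 - σ (x i * z))) ^ 2 /
        ∏ i, (if b i then p else 1 - p) = 𝔼 u, (1 + corr σ p u) ^ n := by
  have h1 (x : Fin n → Hypercube d) : ∑ b : Fin n → Bool,
      (𝔼 z, ∏ i, (if b i then (σ (x i * z) : ℝ) else 1 - σ (x i * z))) ^ 2 /
        ∏ i, (if b i then p else 1 - p)
      = 𝔼 z, 𝔼 z', ∏ i, ∑ c : Bool, (if c then (σ (x i * z) : ℝ) else 1 - σ (x i * z)) *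
        (if c then (σ (x i * z') : ℝ) else 1 - σ (x i * z')) / (if c then p else 1 - p) := by
    -- The square becomes a double average over z and z', and the sum over edge patterns factors
    -- over the old vertices.
    simp_rw [Fintype.prod_sum, expect_sum_comm]
    refine Finset.sum_congr rfl fun b _ => ?_
    rw [pow_two, expect_mul_expect, expect_div]
    refine expect_congr rfl fun z _ => ?_
    rw [expect_div]
    refine expect_congr rfl fun z' _ => ?_
    rw [Finset.prod_div_distrib, Finset.prod_mul_distrib]
  simp_rw [h1]
  rw [expect_comm]
  have h2 (z : Hypercube d) : 𝔼 x : Fin n → Hypercube d, 𝔼 z', ∏ i, ∑ c : Bool,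
      (if c then (σ (x i * z) : ℝ) else 1 - σ (x i * z)) *
        (if c then (σ (x i * z') : ℝ) else 1 - σ (x i * z')) / (if c then p else 1 - p)
      = 𝔼 u, (1 + corr σ p u) ^ n := by
    rw [expect_comm, ← Hypercube.expect_mul_left z]
    refine expect_congr rfl fun z' _ => ?_
    have e : z * (z * z') = z' := by rw [← mul_assoc, Hypercube.mul_self, one_mul]
    rw [← congrArg (corr σ p) e, ← expect_bernoulli_mul σ hp hp0 hp1, expect_pow]
    simp [Fintype.piFinset_univ]
  simp_rw [h2]
  simp

lemma ragMass_eq_expect (σ : Connection d) (G : SimpleGraph (Fin n)) :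
    σ.ragMass G = 𝔼 x : Fin n → Hypercube d, edgeProd (fun i j => (σ (x i * x j) : ℝ)) G := by
  rw [Fintype.expect_eq_sum_div_card]; rfl

lemma expect_snoc {X : Type*} [Fintype X] [Nonempty X] (F : (Fin (n + 1) → X) → ℝ) :
    𝔼 x, F x = 𝔼 x : Fin n → X, 𝔼 z, F (Fin.snoc (α := fun _ => X) x z) := by
  rw [← Fintype.expect_equiv (Fin.snocEquiv (fun _ => X))
    (fun q => F (Fin.snoc (α := fun _ => X) q.2 q.1)) F (fun _ => rfl), ← univ_product_univ,
    expect_product, expect_comm]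

/-- Independence of the last latent vector puts the mass in the form 𝔼 f · h required by the mixture
bound. -/
lemma ragMass_addLast (σ : Connection d) (H : SimpleGraph (Fin n)) (b : Fin n → Bool) :
    σ.ragMass (H.addLast b) = 𝔼 x : Fin n → Hypercube d,
      edgeProd (fun i j => (σ (x i * x j) : ℝ)) H *
        𝔼 z, ∏ i, (if b i then (σ (x i * z) : ℝ) else 1 - σ (x i * z)) := by
  rw [ragMass_eq_expect, expect_snoc]
  simp_rw [edgeProd_addLast]
  simp [mul_expect]

/-- Bound on the divergence of the random algebraic graph from the binomial random graph. -/
lemma sum_ragMass_mul_log_le (σ : Connection d) {p : ℝ} (hp : p = σ.mean) (hp0 : 0 < p)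
    (hp1 : p < 1) (n : ℕ) :
    ∑ G : SimpleGraph (Fin n), σ.ragMass G * Real.log (σ.ragMass G / edgeProd (fun _ _ => p) G)
      ≤ ∑ k ∈ range n, Real.log (𝔼 u, (1 + corr σ p u) ^ k) := by
  induction n with
  | zero =>
    simp [ragMass_eq_expect, edgeProd]
  | succ n ih =>
    rw [sum_eq_sum_addLast, Finset.sum_range_succ, ← expect_chiSq σ hp hp0 hp1]
    refine le_trans ?_ (add_le_add_left ih _)
    have hσ0 (y : Hypercube d) : (0 : ℝ) ≤ σ y := (σ y).2.1
    have hσ1 (y : Hypercube d) : (σ y : ℝ) ≤ 1 := (σ y).2.2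
    have hf0 (x : Fin n → Hypercube d) (H : SimpleGraph (Fin n)) :
        0 ≤ edgeProd (fun i j => (σ (x i * x j) : ℝ)) H :=
      edgeProd_nonneg (fun i j => hσ0 _) (fun i j => hσ1 _) H
    have hf1 (x : Fin n → Hypercube d) :
        ∑ H : SimpleGraph (Fin n), edgeProd (fun i j => (σ (x i * x j) : ℝ)) H = 1 :=
      sum_edgeProd _
    have hh0 (x : Fin n → Hypercube d) (b : Fin n → Bool) :
        0 ≤ 𝔼 z, ∏ i, (if b i then (σ (x i * z) : ℝ) else 1 - σ (x i * z)) := by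
      refine expect_nonneg fun z _ => Finset.prod_nonneg fun i _ => ?_
      split_ifs
      · exact hσ0 _
      · exact sub_nonneg.2 (hσ1 _)
    have hh1 (x : Fin n → Hypercube d) : ∑ b : Fin n → Bool,
        𝔼 z, ∏ i, (if b i then (σ (x i * z) : ℝ) else 1 - σ (x i * z)) = 1 := by
      rw [← expect_sum_comm]
      simp_rw [sum_prod_bernoulli]
      exact Fintype.expect_const 1
    have hQ (H : SimpleGraph (Fin n)) : 0 < edgeProd (fun _ _ => p) H :=
      edgeProd_pos (fun _ _ => hp0) (fun _ _ => hp1) H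
    have hq (b : Fin n → Bool) : 0 < ∏ i, (if b i then p else 1 - p) := by
      refine Finset.prod_pos fun i _ => ?_
      split_ifs
      · exact hp0
      · linarith
    have key := sum_mul_log_le_of_mixture _ _ _ _ hf0 hf1 hh0 hh1 hQ hq (sum_prod_bernoulli _)
    simp_rw [ragMass_addLast, edgeProd_addLast, ragMass_eq_expect]
    exact key

end Connection

/-! ### Point masses and the divergence on a finite space -/

namespace SimpleGraph

variable {n : ℕ}

instance : MeasurableSingletonClass (SimpleGraph (Fin n)) where
  measurableSet_singleton G := by
    refine ⟨{G.Adj}, measurableSet_singleton _, ?_⟩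
    ext H
    simp

open Classical in
lemma card_filter_lt_adj (G : SimpleGraph (Fin n)) :
    #{e : Fin n × Fin n | e.1 < e.2 ∧ G.Adj e.1 e.2} = G.edgeSet.ncard := by
  rw [← SimpleGraph.coe_edgeFinset, Set.ncard_coe_finset]
  refine Finset.card_bij (fun e _ => s(e.1, e.2)) ?_ ?_ ?_
  · intro e he
    simpa using (mem_filter.1 he).2.2
  · rintro ⟨a, b⟩ h ⟨a', b'⟩ h' he
    simp only [mem_filter, mem_univ, true_and] at h h'
    rcases Sym2.eq_iff.1 he with ⟨rfl, rfl⟩ | ⟨rfl, rfl⟩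
    · rfl
    · exact absurd h.1 h'.1.not_gt
  · intro e
    induction e with
    | _ a b =>
    intro h
    rw [SimpleGraph.mem_edgeFinset, SimpleGraph.mem_edgeSet] at h
    rcases lt_or_gt_of_ne h.ne with h1 | h1
    · exact ⟨(a, b), by simp [h1, h], rfl⟩
    · exact ⟨(b, a), by simp [h1, h.symm], Sym2.eq_swap⟩

lemma edgeProd_const (p : ℝ) (G : SimpleGraph (Fin n)) :
    edgeProd (fun _ _ => p) G
      = p ^ G.edgeSet.ncard * (1 - p) ^ (n.choose 2 - G.edgeSet.ncard) := by
  classical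
  have h1 := card_filter_lt_adj G
  have h2 := card_filter_lt_adj (⊤ : SimpleGraph (Fin n))
  have h3 : (⊤ : SimpleGraph (Fin n)).edgeSet.ncard = n.choose 2 := by
    rw [← SimpleGraph.coe_edgeFinset, Set.ncard_coe_finset,
      SimpleGraph.card_edgeFinset_top_eq_card_choose_two, Fintype.card_fin]
  have h4 : #{e : Fin n × Fin n | e.1 < e.2} = n.choose 2 := by
    rw [← h3, ← h2]
    congr 1
    ext e
    simpa using fun h : e.1 < e.2 => h.ne
  rw [edgeProd, Finset.prod_ite, Finset.prod_const, Finset.prod_const, filter_filter, filter_filter]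
  have h5 := card_filter_add_card_filter_not
    (s := ({e : Fin n × Fin n | e.1 < e.2} : Finset (Fin n × Fin n))) (fun e => G.Adj e.1 e.2)
  rw [filter_filter, filter_filter, h4] at h5
  have h6 : #{a : Fin n × Fin n | a.1 < a.2 ∧ ¬ G.Adj a.1 a.2}
      = n.choose 2 - G.edgeSet.ncard := by
    rw [← h1]
    have h7 : ∀ a b c : ℕ, a + b = c → b = c - a := by omega
    convert h7 _ _ _ h5
  rw [← h6, ← h1]

lemma binomialRandom_singleton_eq_ofReal (p : unitInterval) (G : SimpleGraph (Fin n)) :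
    binomialRandom (Fin n) p {G} = ENNReal.ofReal (edgeProd (fun _ _ => (p : ℝ)) G) := by
  have h0 : (0 : ℝ) ≤ p := p.2.1
  have h1 : (0 : ℝ) ≤ 1 - p := sub_nonneg.2 p.2.2
  rw [binomialRandom_singleton, edgeProd_const, ENNReal.ofReal_mul (by positivity),
    ENNReal.ofReal_pow h0, ENNReal.ofReal_pow h1, Nat.card_eq_fintype_card, Fintype.card_fin]
  congr 2
  · rw [ENNReal.ofReal, Real.toNNReal_of_nonneg h0]; rfl
  · rw [ENNReal.ofReal, Real.toNNReal_of_nonneg h1]; rfl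

end SimpleGraph

/-- The divergence of a probability on a finite type from one with positive point masses. -/
lemma klDiv_eq_sum_of_finite {α : Type*} [Fintype α] [MeasurableSpace α]
    [MeasurableSingletonClass α] (μ ν : Measure α) [IsProbabilityMeasure μ]
    [IsProbabilityMeasure ν] (f g : α → ℝ) (hf : ∀ a, 0 ≤ f a) (hg : ∀ a, 0 < g a)
    (hμ : ∀ a, μ {a} = ENNReal.ofReal (f a)) (hν : ∀ a, ν {a} = ENNReal.ofReal (g a)) :
    InformationTheory.klDiv μ ν = ENNReal.ofReal (∑ a, f a * Real.log (f a / g a)) := by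
  have hwd : μ = ν.withDensity fun a => ENNReal.ofReal (f a / g a) := by
    refine Measure.ext_of_singleton fun a => ?_
    rw [withDensity_apply _ (measurableSet_singleton a), lintegral_singleton, hμ, hν,
      ← ENNReal.ofReal_mul (div_nonneg (hf a) (hg a).le), div_mul_cancel₀ _ (hg a).ne']
  have hmeas : Measurable fun a => ENNReal.ofReal (f a / g a) := measurable_of_finite _
  have hac : μ ≪ ν := by
    rw [hwd]; exact withDensity_absolutelyContinuous _ _
  -- Almost everywhere means everywhere here, since every singleton has positive ν-mass.
  have hrn : ∀ a, μ.rnDeriv ν a = ENNReal.ofReal (f a / g a) := by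
    have h := Measure.rnDeriv_withDensity ν hmeas
    rw [← hwd] at h
    intro a
    by_contra hne
    have h0 : ν {a} = 0 := measure_mono_null (by simpa using hne) (ae_iff.1 h)
    rw [hν, ENNReal.ofReal_eq_zero] at h0
    exact absurd (hg a) h0.not_gt
  rw [InformationTheory.klDiv_of_ac_of_integrable hac Integrable.of_finite]
  simp only [probReal_univ, add_sub_cancel_right]
  rw [integral_fintype Integrable.of_finite]
  congr 1
  refine Finset.sum_congr rfl fun a _ => ?_
  rw [measureReal_def, hμ, ENNReal.toReal_ofReal (hf a), llr, hrn,
    ENNReal.toReal_ofReal (div_nonneg (hf a) (hg a).le), smul_eq_mul]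

namespace Connection

open SimpleGraph

variable {d n : ℕ}

lemma ragMass_nonneg (σ : Connection d) (G : SimpleGraph (Fin n)) : 0 ≤ σ.ragMass G := by
  rw [ragMass_eq_expect]
  exact expect_nonneg fun x _ => edgeProd_nonneg (W := fun i j => (σ (x i * x j) : ℝ))
    (fun i j => (σ (x i * x j)).2.1) (fun i j => (σ (x i * x j)).2.2) G

lemma sum_ragMass (σ : Connection d) : ∑ G : SimpleGraph (Fin n), σ.ragMass G = 1 := by
  simp_rw [ragMass_eq_expect, ← expect_sum_comm, sum_edgeProd]
  exact Fintype.expect_const 1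

lemma rag_singleton (σ : Connection d) (G : SimpleGraph (Fin n)) :
    σ.rag n {G} = ENNReal.ofReal (σ.ragMass G) := by
  classical
  rw [rag, Measure.finsetSum_apply, Finset.sum_eq_single G]
  · simp
  · intro H _ h
    simp [h]
  · simp

instance (σ : Connection d) : IsProbabilityMeasure (σ.rag n) := by
  classical
  constructor
  rw [rag, Measure.finsetSum_apply]
  simp only [Measure.smul_apply, measure_univ, smul_eq_mul, mul_one]
  rw [← ENNReal.ofReal_sum_of_nonneg fun G _ => σ.ragMass_nonneg G]
  convert ENNReal.ofReal_one
  convert σ.sum_ragMass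

lemma klToBinomial_le (σ : Connection d) {p : ℝ} (hp : p = σ.mean) (hp0 : 0 < p)
    (hp1 : p < 1) (n : ℕ) :
    σ.klToBinomial n ≤ ENNReal.ofReal
      (∑ k ∈ range n, Real.log (𝔼 u, (1 + corr σ p u) ^ k)) := by
  rw [klToBinomial, klDiv_eq_sum_of_finite _ _ (fun G => σ.ragMass G)
    (fun G => edgeProd (fun _ _ => p) G) (fun G => σ.ragMass_nonneg G)
    (fun G => edgeProd_pos (fun _ _ => hp0) (fun _ _ => hp1) G) σ.rag_singleton
    (by rw [hp]; exact binomialRandom_singleton_eq_ofReal _)]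
  exact ENNReal.ofReal_le_ofReal (sum_ragMass_mul_log_le σ hp hp0 hp1 n)

/-- Treated separately because the second-moment argument divides by p; here both laws give full
mass to the empty graph. -/
lemma klToBinomial_of_mean_eq_zero (σ : Connection d) (h : (σ.mean : ℝ) = 0) (n : ℕ) :
    σ.klToBinomial n = 0 := by
  have hσ (x : Hypercube d) : (σ x : ℝ) = 0 := by
    rw [mean_eq_expect, expect_eq_zero_iff_of_nonneg fun x _ => (σ x).2.1] at h
    exact h x (mem_univ x)
  have h1 : σ.rag n = binomialRandom (Fin n) σ.mean := by
    refine Measure.ext_of_singleton fun G => ?_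
    rw [rag_singleton, binomialRandom_singleton_eq_ofReal, ragMass_eq_expect, h]
    simp [hσ]
  rw [klToBinomial, h1, InformationTheory.klDiv_self]

end Connection

/-! ### Nonasymptotic bound on the divergence -/

/-- The missing mass 1 - ∑ w_i is placed at 0, where cosh - 1 vanishes. -/
lemma Real.cosh_sum_sub_one_le {ι : Type*} (t : Finset ι) (w y : ι → ℝ)
    (hw : ∀ i ∈ t, 0 ≤ w i) (hw1 : ∑ i ∈ t, w i ≤ 1) :
    Real.cosh (∑ i ∈ t, w i * y i) - 1 ≤ ∑ i ∈ t, w i * (Real.cosh (y i) - 1) := by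
  have h := Real.convexOn_cosh.map_add_sum_le (t := t) (w := w) (p := y)
    (v := 1 - ∑ i ∈ t, w i) (q := 0) hw (by ring) (fun _ _ => Set.mem_univ _)
    (sub_nonneg.2 hw1) (Set.mem_univ _)
  simp only [smul_eq_mul, mul_zero, zero_add, Real.cosh_zero, mul_one] at h
  simp only [mul_sub, mul_one, Finset.sum_sub_distrib]
  linarith

namespace Connection

open Hypercube

variable {d : ℕ}

lemma IsSymmetric.symmFun {σ : Connection d} (hσ : σ.IsSymmetric) :
    SymmFun fun x => (σ x : ℝ) := fun π x => by simp only [hσ π x]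

/-- It is a second moment, hence an average of nonnegative terms. This permits raising 1 + γ ≤ e^γ
to powers. -/
lemma zero_le_one_add_corr (σ : Connection d) {p : ℝ} (hp : p = σ.mean) (hp0 : 0 < p) (hp1 : p < 1)
    (u : Hypercube d) : 0 ≤ 1 + corr σ p u := by
  rw [← mul_one u, ← expect_bernoulli_mul σ hp hp0 hp1]
  refine expect_nonneg fun y _ => Finset.sum_nonneg fun c _ => ?_
  have h (z : Hypercube d) : 0 ≤ if c then (σ (y * z) : ℝ) else 1 - σ (y * z) := by
    split_ifs
    · exact (σ (y * z)).2.1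
    · exact sub_nonneg.2 (σ (y * z)).2.2
  have h' : 0 ≤ if c then p else 1 - p := by
    split_ifs <;> linarith
  exact div_nonneg (mul_nonneg (h _) (h _)) h'

lemma expect_corr (σ : Connection d) {p : ℝ} (hp : p = σ.mean) : 𝔼 u, corr σ p u = 0 := by
  simp only [corr]
  rw [← expect_div, expect_sub_distrib, expect_comm, Fintype.expect_const]
  have h (z : Hypercube d) : 𝔼 u, (σ (u * z) : ℝ) * σ z = p * σ z := by
    rw [← expect_mul]
    congr 1
    rw [hp, mean_eq_expect]
    exact Fintype.expect_equiv (Equiv.mulRight z) _ _ fun _ => rfl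
  simp_rw [h]
  rw [← mul_expect, ← mean_eq_expect, ← hp, ← pow_two, sub_self, zero_div]

/-- The divergence is at most an exponential moment of the autocorrelation. -/
lemma klToBinomial_le_cosh (σ : Connection d) {p : ℝ} (hp : p = σ.mean) (hp0 : 0 < p)
    (hp1 : p < 1) (n : ℕ) :
    σ.klToBinomial n ≤ ENNReal.ofReal (2 * n * 𝔼 u, (Real.cosh (n * corr σ p u) - 1)) := by
  refine (klToBinomial_le σ hp hp0 hp1 n).trans (ENNReal.ofReal_le_ofReal ?_)
  set E := 𝔼 u, (Real.cosh (n * corr σ p u) - 1) with hE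
  have hE0 : 0 ≤ E := expect_nonneg fun u _ => sub_nonneg.2 (Real.one_le_cosh _)
  have key (k : ℕ) (hk : k ∈ range n) : Real.log (𝔼 u, (1 + corr σ p u) ^ k) ≤ 2 * E := by
    have hkn : (k : ℝ) ≤ n := by exact_mod_cast (mem_range.1 hk).le
    have h1 (u : Hypercube d) : (1 + corr σ p u) ^ k
        ≤ 1 + k * corr σ p u + 2 * (Real.cosh (n * corr σ p u) - 1) := by
      have e1 : (1 + corr σ p u) ^ k ≤ Real.exp (k * corr σ p u) := by
        rw [Real.exp_nat_mul]
        refine pow_le_pow_left₀ (zero_le_one_add_corr σ hp hp0 hp1 u) ?_ k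
        linarith [Real.add_one_le_exp (corr σ p u)]
      -- With t = kγ, e^t = 2 cosh t - e^{-t} and e^{-t} ≥ 1 - t, so e^t ≤ 1 + t + 2(cosh t - 1).
      have e2 := Real.add_one_le_exp (-(k * corr σ p u))
      have e3 := Real.cosh_eq (k * corr σ p u)
      have e4 : Real.cosh (k * corr σ p u) ≤ Real.cosh (n * corr σ p u) := by
        rw [Real.cosh_le_cosh, abs_mul, abs_mul, Nat.abs_cast, Nat.abs_cast]
        gcongr
      linarith
    have h2 : 𝔼 u, (1 + corr σ p u) ^ k ≤ 1 + 2 * E := by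
      refine (expect_le_expect fun u _ => h1 u).trans_eq ?_
      rw [expect_add_distrib, expect_add_distrib, ← mul_expect, ← mul_expect, expect_corr σ hp,
        Fintype.expect_const, ← hE]
      ring
    have h0 : 0 ≤ 𝔼 u, (1 + corr σ p u) ^ k :=
      expect_nonneg fun u _ => pow_nonneg (zero_le_one_add_corr σ hp hp0 hp1 u) k
    rcases h0.eq_or_lt with h3 | h3
    · rw [← h3, Real.log_zero]; positivity
    · linarith [Real.log_le_sub_one_of_pos h3]
  refine (Finset.sum_le_sum key).trans_eq ?_
  rw [Finset.sum_const, card_range, nsmul_eq_mul]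
  ring

/-- The normalized Fourier weight of degree `i`. -/
noncomputable def relWeight (σ : Connection d) (p : ℝ) (i : ℕ) : ℝ :=
  weight (fun x => (σ x : ℝ)) i / (p * (1 - p))

lemma relWeight_nonneg (σ : Connection d) {p : ℝ} (hp0 : 0 < p) (hp1 : p < 1) (i : ℕ) :
    0 ≤ relWeight σ p i :=
  div_nonneg (weight_nonneg _ _) (mul_nonneg hp0.le (by linarith))

lemma corr_eq_sum {σ : Connection d} (hσ : σ.IsSymmetric) {p : ℝ} (hp : p = σ.mean)
    (u : Hypercube d) : corr σ p u = ∑ i ∈ Icc 1 d, relWeight σ p i * kraw i u := by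
  have h : range (d + 1) = insert 0 (Icc 1 d) := by ext i; simp; omega
  rw [corr, hσ.symmFun.autocorrelation, h, Finset.sum_insert (by simp), weight_zero, kraw_zero,
    ← mean_eq_expect, ← hp, mul_one, add_sub_cancel_left, Finset.sum_div]
  exact Finset.sum_congr rfl fun i _ => by rw [relWeight]; ring

/-- At the identity every `kraw i` is 1, so the sum is Var σ / (p(1 - p)); it is at most 1 because
σ² ≤ σ. -/
lemma sum_relWeight_le {σ : Connection d} (hσ : σ.IsSymmetric) {p : ℝ} (hp : p = σ.mean)
    (hp0 : 0 < p) (hp1 : p < 1) : ∑ i ∈ Icc 1 d, relWeight σ p i ≤ 1 := by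
  have h := corr_eq_sum hσ hp 1
  rw [Finset.sum_congr rfl fun i hi => by rw [kraw_apply_one (mem_Icc.1 hi).2, mul_one]] at h
  rw [← h, corr, div_le_one (mul_pos hp0 (by linarith))]
  have h1 : 𝔼 z, (σ (1 * z) : ℝ) * σ z ≤ p := by
    rw [hp, mean_eq_expect]
    refine expect_le_expect fun z _ => ?_
    exact mul_le_of_le_one_left (σ z).2.1 (σ (1 * z)).2.2
  linarith

/-- Nonasymptotic bound on the divergence in terms of the extreme Fourier weights. -/
theorem klToBinomial_le_of_relWeight_le {σ : Connection d} (hσ : σ.IsSymmetric) {p : ℝ}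
    (hp : p = σ.mean) (hp0 : 0 < p) (hp1 : p < 1) {n : ℕ} {A B D : ℝ} (hd : 12 ≤ d)
    (hdn : (192 * n : ℝ) ≤ d)
    (h1 : relWeight σ p 1 ≤ A) (h1' : relWeight σ p (d - 1) ≤ A) (hA : 72 * (n * A) ^ 2 ≤ d)
    (h2 : relWeight σ p 2 ≤ B) (h2' : relWeight σ p (d - 2) ≤ B)
    (h3 : relWeight σ p d ≤ D) (hD : 6 * (n * D) ≤ 1) :
    σ.klToBinomial n ≤ ENNReal.ofReal (10 ^ 8 *
      ((n : ℝ) ^ 3 / d ^ 3 + n ^ 3 * A ^ 2 / d + n ^ 3 * B ^ 2 / d ^ 2 + n ^ 3 * D ^ 2)) := by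
  refine (klToBinomial_le_cosh σ hp hp0 hp1 n).trans (ENNReal.ofReal_le_ofReal ?_)
  have hd' : (12 : ℝ) ≤ d := by exact_mod_cast hd
  have hn0 : (0 : ℝ) ≤ n := Nat.cast_nonneg n
  set w := relWeight σ p with hw
  have hw0 (i : ℕ) : 0 ≤ w i := relWeight_nonneg σ hp0 hp1 i
  have hw1 : ∑ i ∈ Icc 1 d, w i ≤ 1 := sum_relWeight_le hσ hp hp0 hp1
  have hwi (i : ℕ) (hi : i ∈ Icc 1 d) : w i ≤ 1 :=
    (Finset.single_le_sum (fun i _ => hw0 i) hi).trans hw1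
  set N : ℕ → ℝ := fun i => 𝔼 u : Hypercube d, (Real.cosh (6 * (n * w i) * kraw i u) - 1) with hN
  have hN0 (i : ℕ) : 0 ≤ N i := expect_nonneg fun u _ => sub_nonneg.2 (Real.one_le_cosh _)
  set M : ℝ := 800000 * (6 * n) ^ 2 / d ^ 3 with hM
  have hM0 : 0 ≤ M := by positivity
  set mid : ℕ → Prop := fun i => 3 ≤ i ∧ i + 3 ≤ d with hmid
  have hmidN : {i ∈ Icc 1 d | ¬ mid i} = {1, 2, d - 2, d - 1, d} := by
    ext i; simp [hmid]; omega
  have hcard : #{i ∈ Icc 1 d | ¬ mid i} ≤ 5 := by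
    rw [hmidN]; exact card_le_five
  have hE : 𝔼 u, (Real.cosh (n * corr σ p u) - 1)
      ≤ M + (N 1 + N 2 + N (d - 2) + N (d - 1) + N d) := by
    -- Each of the five extreme levels gets convex weight 1/6 and the middle levels share the last
    -- sixth in proportion to w_i. The arguments of cosh are rescaled by 6 to compensate.
    set l : ℕ → ℝ := fun i => if mid i then w i / 6 else 1 / 6 with hl
    set y : ℕ → Hypercube d → ℝ := fun i u =>
      if mid i then 6 * n * kraw i u else 6 * (n * w i) * kraw i u with hy
    have hl0 (i : ℕ) : 0 ≤ l i := by
      simp only [hl]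
      split_ifs
      · exact div_nonneg (hw0 i) (by norm_num)
      · norm_num
    have hsplit (F G : ℕ → ℝ) : ∑ i ∈ Icc 1 d, (if mid i then F i else G i)
        = ∑ i ∈ Icc 1 d with mid i, F i + ∑ i ∈ Icc 1 d with ¬ mid i, G i :=
      Finset.sum_ite _ _
    have hwm : ∑ i ∈ Icc 1 d with mid i, w i ≤ 1 :=
      (Finset.sum_le_sum_of_subset_of_nonneg (filter_subset _ _) fun i _ _ => hw0 i).trans hw1
    have hl1 : ∑ i ∈ Icc 1 d, l i ≤ 1 := by
      rw [hsplit, ← Finset.sum_div, Finset.sum_const, nsmul_eq_mul]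
      have : (#{i ∈ Icc 1 d | ¬ mid i} : ℝ) ≤ 5 := by exact_mod_cast hcard
      linarith
    have hly (u : Hypercube d) : n * corr σ p u = ∑ i ∈ Icc 1 d, l i * y i u := by
      rw [corr_eq_sum hσ hp, mul_sum]
      refine Finset.sum_congr rfl fun i _ => ?_
      simp only [hl, hy]
      split_ifs <;> ring
    calc 𝔼 u, (Real.cosh (n * corr σ p u) - 1)
        ≤ 𝔼 u : Hypercube d, ∑ i ∈ Icc 1 d, l i * (Real.cosh (y i u) - 1) := by
          refine expect_le_expect fun u _ => ?_
          rw [hly]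
          exact Real.cosh_sum_sub_one_le _ _ _ (fun i _ => hl0 i) hl1
      _ = ∑ i ∈ Icc 1 d, l i * 𝔼 u : Hypercube d, (Real.cosh (y i u) - 1) := by
          rw [expect_sum_comm]
          simp_rw [← mul_expect]
      _ ≤ ∑ i ∈ Icc 1 d, if mid i then w i / 6 * M else N i := by
          refine Finset.sum_le_sum fun i hi => ?_
          simp only [hl, hy]
          split_ifs with h
          · refine mul_le_mul_of_nonneg_left ?_ (div_nonneg (hw0 i) (by norm_num))
            -- The requirement 6n ≤ d/32 is the hypothesis 192n ≤ d.
            refine expect_cosh_kraw_mid hd h.1 h.2 ?_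
            rw [abs_of_nonneg (by positivity)]
            linarith
          · have := hN0 i
            change 1 / 6 * N i ≤ N i
            linarith
      _ ≤ M + ∑ i ∈ Icc 1 d with ¬ mid i, N i := by
          rw [hsplit, ← Finset.sum_mul, ← Finset.sum_div]
          gcongr
          nlinarith
      _ = _ := by
          rw [hmidN, Finset.sum_insert, Finset.sum_insert, Finset.sum_insert, Finset.sum_insert,
            Finset.sum_singleton]
          · ring
          all_goals simp; try omega
  have hA2 {i : ℕ} (h : w i ≤ A) : (6 * (n * w i)) ^ 2 ≤ 36 * (n * A) ^ 2 := by
    have := hw0 i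
    calc (6 * (n * w i)) ^ 2 ≤ (6 * (n * A)) ^ 2 := by gcongr
      _ = _ := by ring
  have hB2 {i : ℕ} (h : w i ≤ B) : (6 * (n * w i)) ^ 2 ≤ 36 * (n * B) ^ 2 := by
    have := hw0 i
    calc (6 * (n * w i)) ^ 2 ≤ (6 * (n * B)) ^ 2 := by gcongr
      _ = _ := by ring
  have hNsub (i : ℕ) (hi : i ≤ d) :
      N (d - i) = 𝔼 u : Hypercube d, (Real.cosh (6 * (n * w (d - i)) * kraw i u) - 1) := by
    simp only [hN, cosh_kraw_sub hi]
  have hlev1 (a : ℝ) (ha : a ^ 2 ≤ 36 * (n * A) ^ 2) :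
      𝔼 u : Hypercube d, (Real.cosh (a * kraw 1 u) - 1) ≤ 72 * (n * A) ^ 2 / d := by
    refine (expect_cosh_kraw_one (by omega) (by linarith)).trans ?_
    exact div_le_div_of_nonneg_right (by linarith) (by positivity)
  have hlev2 (a : ℝ) (ha : a ^ 2 ≤ 36 * (n * B) ^ 2) (ha0 : 0 ≤ a) (ha1 : a ≤ 6 * n) :
      𝔼 u : Hypercube d, (Real.cosh (a * kraw 2 u) - 1) ≤ 57600 * (n * B) ^ 2 / d ^ 2 := by
    refine (expect_cosh_kraw_two (by omega) ?_).trans ?_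
    · rw [abs_of_nonneg ha0]; linarith
    · have e1 : ((d : ℝ) / 2) ^ 2 ≤ (d - 1) ^ 2 :=
        pow_le_pow_left₀ (by positivity) (by linarith) 2
      calc 400 * (a / (d - 1)) ^ 2 = 400 * a ^ 2 / (d - 1) ^ 2 := by rw [div_pow]; ring
        _ ≤ 400 * (36 * (n * B) ^ 2) / (d / 2) ^ 2 := by gcongr
        _ = _ := by field_simp; ring
  have hN1 : N 1 ≤ 72 * (n * A) ^ 2 / d := hlev1 _ (hA2 h1)
  have hN1' : N (d - 1) ≤ 72 * (n * A) ^ 2 / d := by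
    rw [hNsub 1 (by omega)]; exact hlev1 _ (hA2 h1')
  have h6 (i : ℕ) (hi : i ∈ Icc 1 d) : 6 * (n * w i) ≤ 6 * n := by
    have := mul_le_mul_of_nonneg_left (hwi i hi) hn0
    linarith
  have h60 (i : ℕ) : 0 ≤ 6 * (n * w i) := by have := hw0 i; positivity
  have hN2 : N 2 ≤ 57600 * (n * B) ^ 2 / d ^ 2 :=
    hlev2 _ (hB2 h2) (h60 2) (h6 2 (by simp; omega))
  have hN2' : N (d - 2) ≤ 57600 * (n * B) ^ 2 / d ^ 2 := by
    rw [hNsub 2 (by omega)]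
    exact hlev2 _ (hB2 h2') (h60 _) (h6 _ (by simp; omega))
  -- The top character is ±1, so its cosh is deterministic and averaging gains nothing; only
  -- smallness of nD helps.
  have hNd : N d ≤ 108 * (n * D) ^ 2 := by
    have e := hNsub 0 (Nat.zero_le d)
    simp only [Nat.sub_zero, kraw_zero, mul_one, Fintype.expect_const] at e
    rw [e]
    have e0 := h60 d
    have e1 : 6 * (n * w d) ≤ 6 * (n * D) := by gcongr
    refine (Real.cosh_sub_one_le _).trans ?_
    rw [abs_of_nonneg e0]
    have e2 : Real.exp (6 * (n * w d)) ≤ 3 := by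
      have : Real.exp (6 * (n * w d)) ≤ Real.exp 1 := Real.exp_le_exp.2 (by linarith)
      linarith [Real.exp_one_lt_d9]
    calc (6 * (n * w d)) ^ 2 * Real.exp (6 * (n * w d)) ≤ (6 * (n * D)) ^ 2 * 3 := by gcongr
      _ = _ := by ring
  calc 2 * n * 𝔼 u, (Real.cosh (n * corr σ p u) - 1)
      ≤ 2 * n * (M + (72 * (n * A) ^ 2 / d + 57600 * (n * B) ^ 2 / d ^ 2
        + 57600 * (n * B) ^ 2 / d ^ 2 + 72 * (n * A) ^ 2 / d + 108 * (n * D) ^ 2)) := by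
        gcongr
        linarith
    _ = 57600000 * ((n : ℝ) ^ 3 / d ^ 3) + 288 * (n ^ 3 * A ^ 2 / d)
        + 230400 * (n ^ 3 * B ^ 2 / d ^ 2) + 216 * (n ^ 3 * D ^ 2) := by rw [hM]; ring
    _ ≤ _ := by
        have e1 : 0 ≤ (n : ℝ) ^ 3 / d ^ 3 := by positivity
        have e2 : 0 ≤ n ^ 3 * A ^ 2 / d := by positivity
        have e3 : 0 ≤ n ^ 3 * B ^ 2 / d ^ 2 := by positivity
        have e4 : 0 ≤ n ^ 3 * D ^ 2 := by positivity
        linarith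

end Connection

/-! ### Asymptotics for general and even connections -/

namespace Connection

open Hypercube

/-- As p ≤ 1 - c, log(1/p) is at least l = -log(1 - c) > 0. Additive constants in the level
inequalities are therefore multiples of log(1/p). -/
lemma exists_relWeight_le {c : ℝ} (hc0 : 0 < c) (hc1 : c < 1) :
    ∃ C : ℝ, 0 < C ∧ ∀ {d : ℕ} {σ : Connection d} {p : ℝ}, σ.IsSymmetric → p = σ.mean → 0 < p →
      p ≤ 1 - c → 2 ≤ d →
      relWeight σ p 1 ≤ C * (p * Real.log (1 / p)) ∧
      relWeight σ p (d - 1) ≤ C * (p * Real.log (1 / p)) ∧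
      relWeight σ p 2 ≤ C * (p * Real.log (1 / p) ^ 2) ∧
      relWeight σ p (d - 2) ≤ C * (p * Real.log (1 / p) ^ 2) ∧
      relWeight σ p d ≤ C * (σ.fluctuation ^ 2 / (d * p)) := by
  set l := -Real.log (1 - c) with hl
  have hl0 : 0 < l := by
    have := Real.log_neg (show 0 < 1 - c by linarith) (by linarith)
    linarith
  refine ⟨4 * (1 + 1 / l) / c + (4 * (1 + 1 / l) + 1 / l) ^ 2 / c + 1 / c, by positivity, ?_⟩
  intro d σ p hσ hp hp0 hpc hd
  set L := Real.log (1 / p) with hL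
  have hLl : l ≤ L := by
    rw [hL, one_div, Real.log_inv, hl]
    exact neg_le_neg (Real.log_le_log hp0 hpc)
  have hL0 : 0 < L := hl0.trans_le hLl
  have hLl1 : 1 ≤ 1 / l * L := by
    rw [one_div, inv_mul_eq_div, le_div_iff₀ hl0]; linarith
  have h2L : Real.log (2 / p) ≤ (1 + 1 / l) * L := by
    rw [show (2 : ℝ) / p = 2 * (1 / p) by ring, Real.log_mul two_ne_zero (by positivity)]
    have := Real.log_two_lt_d9
    linarith
  have hL2 : 0 ≤ Real.log (2 / p) :=
    Real.log_nonneg (by rw [le_div_iff₀ hp0]; linarith)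
  have hd0 : (0 : ℝ) < d := by exact_mod_cast (by omega : 0 < d)
  have hrel {i : ℕ} {W : ℝ} (h : weight (fun x => (σ x : ℝ)) i ≤ W) :
      relWeight σ p i ≤ W / (p * c) := by
    have hW := (weight_nonneg _ _).trans h
    rw [relWeight]
    gcongr
    linarith
  have hσ1 (x : Hypercube d) : |(σ x : ℝ)| ≤ 1 := by
    rw [abs_of_nonneg (σ x).2.1]; exact (σ x).2.2
  have hσp : 𝔼 x, |(σ x : ℝ)| = p := by
    rw [hp, mean_eq_expect]
    exact expect_congr rfl fun x _ => abs_of_nonneg (σ x).2.1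
  have hτ1 (x : Hypercube d) : |(σ x : ℝ) * walsh univ x| ≤ 1 := by
    rw [abs_mul, abs_walsh, mul_one]; exact hσ1 x
  have hτp : 𝔼 x, |(σ x : ℝ) * walsh univ x| = p := by
    simp_rw [abs_mul, abs_walsh, mul_one]
    exact hσp
  have hpL : 0 ≤ p * L := by positivity
  have hpL2 : 0 ≤ p * L ^ 2 := by positivity
  have hF : 0 ≤ σ.fluctuation ^ 2 / (d * p) := by positivity
  have hC0 : 0 ≤ 4 * (1 + 1 / l) / c := by positivity
  have hC1 : 0 ≤ (4 * (1 + 1 / l) + 1 / l) ^ 2 / c := by positivity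
  have hC2 : 0 ≤ 1 / c := by positivity
  have lev1 {i : ℕ} (h : weight (fun x => (σ x : ℝ)) i ≤ 4 * p ^ 2 * Real.log (2 / p)) :
      relWeight σ p i ≤ 4 * (1 + 1 / l) / c * (p * L) := by
    refine (hrel h).trans ?_
    calc 4 * p ^ 2 * Real.log (2 / p) / (p * c)
        ≤ 4 * p ^ 2 * ((1 + 1 / l) * L) / (p * c) := by gcongr
      _ = _ := by field_simp
  have lev2 {i : ℕ}
      (h : weight (fun x => (σ x : ℝ)) i ≤ (p * (4 * Real.log (2 / p) + 1)) ^ 2) :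
      relWeight σ p i ≤ (4 * (1 + 1 / l) + 1 / l) ^ 2 / c * (p * L ^ 2) := by
    refine (hrel h).trans ?_
    calc (p * (4 * Real.log (2 / p) + 1)) ^ 2 / (p * c)
        ≤ (p * (4 * ((1 + 1 / l) * L) + 1 / l * L)) ^ 2 / (p * c) := by gcongr
      _ = _ := by field_simp
  have mono1 {a : ℝ} (h : a ≤ 4 * (1 + 1 / l) / c * (p * L)) :
      a ≤ (4 * (1 + 1 / l) / c + (4 * (1 + 1 / l) + 1 / l) ^ 2 / c + 1 / c) * (p * L) := by
    refine h.trans (mul_le_mul_of_nonneg_right ?_ hpL)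
    linarith
  have mono2 {a : ℝ} (h : a ≤ (4 * (1 + 1 / l) + 1 / l) ^ 2 / c * (p * L ^ 2)) :
      a ≤ (4 * (1 + 1 / l) / c + (4 * (1 + 1 / l) + 1 / l) ^ 2 / c + 1 / c) * (p * L ^ 2) := by
    refine h.trans (mul_le_mul_of_nonneg_right ?_ hpL2)
    linarith
  refine ⟨mono1 (lev1 ?_), mono1 (lev1 ?_), mono2 (lev2 ?_), mono2 (lev2 ?_), ?_⟩
  · exact weight_one_le (by omega) hp0 hσ1 hσp
  · rw [weight_sub _ (by omega)]
    exact weight_one_le (by omega) hp0 hτ1 hτp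
  · exact weight_two_le hd hp0 hσ1 hσp
  · rw [weight_sub _ hd]
    exact weight_two_le hd hp0 hτ1 hτp
  · refine (hrel (weight_top_le (by omega) σ hσ.symmFun)).trans ?_
    calc σ.fluctuation ^ 2 / (2 * d) / (p * c)
        = 1 / 2 * (1 / c * (σ.fluctuation ^ 2 / (d * p))) := by field_simp
      _ ≤ 1 / c * (σ.fluctuation ^ 2 / (d * p)) := by
        have : 0 ≤ 1 / c * (σ.fluctuation ^ 2 / (d * p)) := by positivity
        linarith
      _ ≤ _ := mul_le_mul_of_nonneg_right (by linarith) hF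

/-- The divergence vanishes if the bounds on the extreme Fourier weights do. -/
lemma tendsto_klToBinomial {d : ℕ → ℕ} {σ : (n : ℕ) → Connection (d n)} {p A B D : ℕ → ℝ}
    (hσ : ∀ n, (σ n).IsSymmetric) (hp : ∀ n, p n = (σ n).mean)
    (hnd : Tendsto (fun n : ℕ => (n : ℝ) / d n) atTop (𝓝 0))
    (hA : Tendsto (fun n : ℕ => (n : ℝ) ^ 3 * A n ^ 2 / d n) atTop (𝓝 0))
    (hB : Tendsto (fun n : ℕ => (n : ℝ) ^ 3 * B n ^ 2 / d n ^ 2) atTop (𝓝 0))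
    (hD : Tendsto (fun n : ℕ => (n : ℝ) ^ 3 * D n ^ 2) atTop (𝓝 0))
    (h : ∀ᶠ n in atTop, 0 < p n → 12 ≤ d n → p n < 1 ∧
      relWeight (σ n) (p n) 1 ≤ A n ∧ relWeight (σ n) (p n) (d n - 1) ≤ A n ∧
      relWeight (σ n) (p n) 2 ≤ B n ∧ relWeight (σ n) (p n) (d n - 2) ≤ B n ∧
      relWeight (σ n) (p n) (d n) ≤ D n)
    (hd : ∀ᶠ n in atTop, 0 < d n) :
    Tendsto (fun n => (σ n).klToBinomial n) atTop (𝓝 0) := by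
  have hlim : Tendsto (fun n : ℕ => ENNReal.ofReal (10 ^ 8 * ((n : ℝ) ^ 3 / d n ^ 3
      + n ^ 3 * A n ^ 2 / d n + n ^ 3 * B n ^ 2 / d n ^ 2 + n ^ 3 * D n ^ 2))) atTop (𝓝 0) := by
    have h1 : Tendsto (fun n : ℕ => (n : ℝ) ^ 3 / d n ^ 3) atTop (𝓝 0) := by
      simpa [div_pow] using hnd.pow 3
    have h2 := (((h1.add hA).add hB).add hD).const_mul (10 ^ 8)
    simpa using ENNReal.tendsto_ofReal h2
  refine tendsto_of_tendsto_of_tendsto_of_le_of_le' tendsto_const_nhds hlim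
    (Eventually.of_forall fun n => zero_le) ?_
  -- The thresholds 1/192, 1/72 and 1/36 give 192n ≤ d, 72(nA)² ≤ d and 6nD ≤ 1, the last two
  -- through n² ≤ n³.
  filter_upwards [h, hd, hnd.eventually (gt_mem_nhds (show (0 : ℝ) < 1 / 192 by norm_num)),
    hA.eventually (gt_mem_nhds (show (0 : ℝ) < 1 / 72 by norm_num)),
    hD.eventually (gt_mem_nhds (show (0 : ℝ) < 1 / 36 by norm_num)), eventually_ge_atTop 1]
    with n h1 hd0 h2 h3 h4 hn
  have hp0 : 0 ≤ p n := by rw [hp]; exact (σ n).mean.2.1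
  rcases hp0.eq_or_lt with h0 | h0
  · rw [klToBinomial_of_mean_eq_zero _ (by rw [← hp, ← h0])]
    exact zero_le
  have hn' : (1 : ℝ) ≤ n := by exact_mod_cast hn
  have hd0' : (0 : ℝ) < d n := by exact_mod_cast hd0
  have hdn : (192 * n : ℝ) ≤ d n := by
    rw [div_lt_iff₀ hd0'] at h2; linarith
  have hd12 : 12 ≤ d n := by
    have : (12 : ℝ) ≤ d n := by linarith
    exact_mod_cast this
  obtain ⟨hp1, w1, w1', w2, w2', w3⟩ := h1 h0 hd12
  have hn3 : (n : ℝ) ^ 2 ≤ n ^ 3 := pow_le_pow_right₀ hn' (by norm_num)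
  refine klToBinomial_le_of_relWeight_le (hσ n) (hp n) h0 hp1 hd12 hdn w1 w1' ?_ w2 w2' w3 ?_
  · rw [div_lt_iff₀ hd0'] at h3
    have := mul_le_mul_of_nonneg_right hn3 (sq_nonneg (A n))
    rw [mul_pow]; linarith
  · have := mul_le_mul_of_nonneg_right hn3 (sq_nonneg (D n))
    have e : (n * D n) ^ 2 < (1 / 6) ^ 2 := by rw [mul_pow]; norm_num; linarith
    linarith [(abs_lt_of_sq_lt_sq' e (by norm_num)).2]

lemma rpow_three_halves_sq (n : ℕ) : ((n : ℝ) ^ (3 / 2 : ℝ)) ^ 2 = (n : ℝ) ^ 3 := by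
  rw [← Real.rpow_natCast, ← Real.rpow_mul (Nat.cast_nonneg n), ← Real.rpow_natCast]
  norm_num

lemma tendsto_of_isLittleO_max {f g : ℕ → ℝ} {d : ℕ → ℕ} (hf : ∀ n, 0 ≤ f n) (hg : ∀ n, 0 ≤ g n)
    (h : (fun n => max (f n) (g n)) =o[atTop] fun n => (d n : ℝ)) :
    Tendsto (fun n => f n / d n) atTop (𝓝 0) ∧ Tendsto (fun n => g n / d n) atTop (𝓝 0) := by
  have h0 := h.tendsto_div_nhds_zero
  constructor
  · refine squeeze_zero (fun n => div_nonneg (hf n) (Nat.cast_nonneg _)) (fun n => ?_) h0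
    gcongr
    exact le_max_left _ _
  · refine squeeze_zero (fun n => div_nonneg (hg n) (Nat.cast_nonneg _)) (fun n => ?_) h0
    gcongr
    exact le_max_right _ _

section Sequences

variable {d : ℕ → ℕ} {σ : (n : ℕ) → Connection (d n)} {p F : ℕ → ℝ}

lemma tendsto_top_weight (C : ℝ)
    (hF : Tendsto (fun n : ℕ => (n : ℝ) ^ (3 / 2 : ℝ) * F n ^ 2 / p n / d n) atTop (𝓝 0)) :
    Tendsto (fun n : ℕ => (n : ℝ) ^ 3 * (C * (F n ^ 2 / (d n * p n))) ^ 2) atTop (𝓝 0) := by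
  have h := (hF.pow 2).const_mul (C ^ 2)
  simp only [ne_eq, OfNat.ofNat_ne_zero, not_false_eq_true, zero_pow, mul_zero] at h
  refine h.congr fun n => ?_
  rw [← rpow_three_halves_sq, div_div, mul_comm (p n)]
  ring

lemma eventually_dim_pos_of_isLittleO {f : ℕ → ℝ} (hf : ∀ᶠ n : ℕ in atTop, (n : ℝ) ≤ f n)
    (h : f =o[atTop] fun n => (d n : ℝ)) :
    Tendsto (fun n : ℕ => (n : ℝ) / d n) atTop (𝓝 0) ∧ ∀ᶠ n in atTop, 0 < d n := by
  have h1 : (fun n : ℕ => (n : ℝ)) =o[atTop] fun n => (d n : ℝ) := by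
    refine IsBigO.trans_isLittleO (IsBigO.of_bound 1 ?_) h
    filter_upwards [hf] with n hn
    rw [Real.norm_of_nonneg (Nat.cast_nonneg n), one_mul]
    exact hn.trans (le_abs_self _)
  refine ⟨h1.tendsto_div_nhds_zero, ?_⟩
  filter_upwards [h1.bound one_pos, eventually_ge_atTop 1] with n h2 hn
  by_contra h0
  have : d n = 0 := by omega
  rw [this] at h2
  simp at h2
  omega

/-- Here n/d ≤ 1/log n; the rest of the argument uses the n log n condition only through n/d → 0 and
d > 0. -/
lemma eventually_dim_pos_of_mul_log_le
    (h : ∀ᶠ n : ℕ in atTop, 1 * n * Real.log n ≤ d n) :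
    Tendsto (fun n : ℕ => (n : ℝ) / d n) atTop (𝓝 0) ∧ ∀ᶠ n in atTop, 0 < d n := by
  have hlog : Tendsto (fun n : ℕ => Real.log n) atTop atTop :=
    Real.tendsto_log_atTop.comp tendsto_natCast_atTop_atTop
  have hpos : ∀ᶠ n : ℕ in atTop, (0 : ℝ) < 1 * n * Real.log n := by
    filter_upwards [hlog.eventually_gt_atTop 0, eventually_ge_atTop 1] with n h1 hn
    have : (1 : ℝ) ≤ n := by exact_mod_cast hn
    positivity
  constructor
  · refine squeeze_zero' (Eventually.of_forall fun n => by positivity) ?_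
      hlog.inv_tendsto_atTop
    filter_upwards [h, hpos, hlog.eventually_gt_atTop 0] with n h1 h2 h3
    have h4 : (0 : ℝ) < d n := h2.trans_le h1
    rw [div_le_iff₀ h4, Pi.inv_apply, inv_mul_eq_div, le_div_iff₀ h3]
    linarith
  · filter_upwards [h, hpos] with n h1 h2
    exact_mod_cast h2.trans_le h1

/-- The general case, with any upper bound on the fluctuation. -/
theorem tendsto_klToBinomial_of_fluctuation_le
    (hσ : ∀ n, (σ n).IsSymmetric) (hp : ∀ n, p n = (σ n).mean)
    {c : ℝ} (hc0 : 0 < c) (hpc : ∀ᶠ n in atTop, p n ≤ 1 - c)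
    (hF : ∀ n, (σ n).fluctuation ≤ F n) (hd : ∀ᶠ n in atTop, 0 < d n)
    (hnd : Tendsto (fun n : ℕ => (n : ℝ) / d n) atTop (𝓝 0))
    (h : (fun n : ℕ => max ((n : ℝ) ^ 3 * p n ^ 2 * Real.log (1 / p n) ^ 2)
      ((n : ℝ) ^ (3 / 2 : ℝ) * F n ^ 2 / p n)) =o[atTop] fun n => (d n : ℝ)) :
    Tendsto (fun n => (σ n).klToBinomial n) atTop (𝓝 0) := by
  have hp0 (n : ℕ) : 0 ≤ p n := by rw [hp]; exact (σ n).mean.2.1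
  have hp1 (n : ℕ) : p n ≤ 1 := by rw [hp]; exact (σ n).mean.2.2
  obtain ⟨h1, h2⟩ := tendsto_of_isLittleO_max
    (fun n => by positivity) (fun n => by have := hp0 n; positivity) h
  -- The margin is truncated at 1/2 because the weight bounds need it below 1.
  obtain ⟨C, hC0, hC⟩ := exists_relWeight_le (c := min c (1 / 2)) (by positivity)
    ((min_le_right _ _).trans_lt (by norm_num))
  refine tendsto_klToBinomial (A := fun n => C * (p n * Real.log (1 / p n)))
    (B := fun n => C * (p n * Real.log (1 / p n) ^ 2)) (D := fun n => C * (F n ^ 2 / (d n * p n)))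
    hσ hp hnd ?_ ?_ (tendsto_top_weight C h2) ?_ hd
  · have e := h1.const_mul (C ^ 2)
    rw [mul_zero] at e
    refine e.congr fun n => ?_
    ring
  -- The level-2 term needs no hypothesis of its own. With L = log(1/p), n³pL/d² is the geometric
  -- mean of n³p²L²/d and n³/d³, and the remaining factor pL³ is bounded.
  · have h3 : Tendsto (fun n : ℕ => (n : ℝ) ^ 3 / d n ^ 3) atTop (𝓝 0) := by
      simpa [div_pow] using hnd.pow 3
    have h13 := h1.mul h3
    rw [mul_zero] at h13
    have h4 := ((Real.continuous_sqrt.tendsto 0).comp h13).const_mul (C ^ 2 * 6)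
    simp only [Real.sqrt_zero, mul_zero] at h4
    refine squeeze_zero (fun n => by positivity) (fun n => ?_) h4
    have hL0 : 0 ≤ Real.log (1 / p n) := by
      rw [one_div, Real.log_inv]
      exact neg_nonneg.2 (Real.log_nonpos (hp0 n) (hp1 n))
    have hpL3 : p n * Real.log (1 / p n) ^ 3 ≤ 6 := by
      rcases (hp0 n).eq_or_lt with h0 | h0
      · rw [← h0]; simp
      -- L³/6 ≤ e^L = 1/p.
      · have e1 := Real.pow_div_factorial_le_exp _ hL0 3
        rw [Real.exp_log (by positivity), div_le_iff₀ (by positivity), div_mul_eq_mul_div,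
          one_mul, le_div_iff₀ h0] at e1
        norm_num [Nat.factorial] at e1 ⊢
        linarith
    have e2 : Real.sqrt ((n : ℝ) ^ 3 * p n ^ 2 * Real.log (1 / p n) ^ 2 / d n
        * ((n : ℝ) ^ 3 / d n ^ 3)) = (n : ℝ) ^ 3 * (p n * Real.log (1 / p n)) / d n ^ 2 := by
      have := hp0 n
      rw [Real.sqrt_eq_iff_mul_self_eq (by positivity) (by positivity)]
      ring
    simp only [Function.comp_apply]
    rw [e2]
    calc (n : ℝ) ^ 3 * (C * (p n * Real.log (1 / p n) ^ 2)) ^ 2 / d n ^ 2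
        = C ^ 2 * (p n * Real.log (1 / p n) ^ 3)
          * ((n : ℝ) ^ 3 * (p n * Real.log (1 / p n)) / d n ^ 2) := by ring
      _ ≤ _ := by
        have := hp0 n
        gcongr
  · filter_upwards [hpc] with n hn h0 hd12
    have hpc' : p n ≤ 1 - min c (1 / 2) := by linarith [min_le_left c (1 / 2)]
    obtain ⟨w1, w1', w2, w2', w3⟩ := hC (hσ n) (hp n) h0 hpc' (by omega)
    refine ⟨by linarith, w1, w1', w2, w2', w3.trans ?_⟩
    have hFl : 0 ≤ (σ n).fluctuation := Finset.sum_nonneg fun _ _ => abs_nonneg _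
    have := hF n
    gcongr

/-- The even case, with any upper bound on the fluctuation. -/
theorem tendsto_klToBinomial_of_isEven
    (hσ : ∀ n, (σ n).IsSymmetric) (hp : ∀ n, p n = (σ n).mean)
    {c : ℝ} (hc0 : 0 < c) (hpc : ∀ᶠ n in atTop, p n ≤ 1 - c)
    (hF : ∀ n, (σ n).fluctuation ≤ F n) (hd : ∀ᶠ n in atTop, 0 < d n)
    (hnd : Tendsto (fun n : ℕ => (n : ℝ) / d n) atTop (𝓝 0))
    (heven : ∀ᶠ n in atTop, (σ n).IsEven ∧ Even (d n))
    (h : (fun n : ℕ => max ((n : ℝ) ^ (3 / 2 : ℝ) * p n * Real.log (1 / p n) ^ 2)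
      ((n : ℝ) ^ (3 / 2 : ℝ) * F n ^ 2 / p n)) =o[atTop] fun n => (d n : ℝ)) :
    Tendsto (fun n => (σ n).klToBinomial n) atTop (𝓝 0) := by
  have hp0 (n : ℕ) : 0 ≤ p n := by rw [hp]; exact (σ n).mean.2.1
  obtain ⟨h1, h2⟩ := tendsto_of_isLittleO_max
    (fun n => by have := hp0 n; positivity) (fun n => by have := hp0 n; positivity) h
  obtain ⟨C, hC0, hC⟩ := exists_relWeight_le (c := min c (1 / 2)) (by positivity)
    ((min_le_right _ _).trans_lt (by norm_num))
  refine tendsto_klToBinomial (A := fun _ => 0)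
    (B := fun n => C * (p n * Real.log (1 / p n) ^ 2)) (D := fun n => C * (F n ^ 2 / (d n * p n)))
    hσ hp hnd (by simp) ?_ (tendsto_top_weight C h2) ?_ hd
  · have e := (h1.pow 2).const_mul (C ^ 2)
    simp only [ne_eq, OfNat.ofNat_ne_zero, not_false_eq_true, zero_pow, mul_zero] at e
    refine e.congr fun n => ?_
    rw [← rpow_three_halves_sq]
    ring
  · filter_upwards [hpc, heven] with n hn he h0 hd12
    have hpc' : p n ≤ 1 - min c (1 / 2) := by linarith [min_le_left c (1 / 2)]
    obtain ⟨w1, w1', w2, w2', w3⟩ := hC (hσ n) (hp n) h0 hpc' (by omega)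
    have hodd {i : ℕ} (hi : Odd i) : relWeight (σ n) (p n) i ≤ 0 := by
      rw [relWeight, weight_eq_zero_of_odd (fun x => by rw [he.1 x]) hi, zero_div]
    refine ⟨by linarith, hodd odd_one, hodd ?_, w2, w2', w3.trans ?_⟩
    · obtain ⟨k, hk⟩ := he.2
      exact ⟨k - 1, by omega⟩
    have hFl : 0 ≤ (σ n).fluctuation := Finset.sum_nonneg fun _ _ => abs_nonneg _
    have := hF n
    gcongr

end Sequences

end Connection

/-! ### Indicators of unions of intervals -/

namespace Connection

variable {d : ℕ}

lemma sum_levelPoint {i : ℕ} (hi : i ≤ d) :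
    ∑ k, ((levelPoint d i k : ℤˣ) : ℤ) = 2 * i - d := by
  have h (k : Fin d) : ((levelPoint d i k : ℤˣ) : ℤ) = 2 * (if (k : ℕ) < i then 1 else 0) - 1 := by
    unfold levelPoint
    split_ifs <;> simp
  simp_rw [h]
  rw [Finset.sum_sub_distrib, ← mul_sum, Finset.sum_boole, Fin.card_filter_val_lt, min_eq_right hi]
  simp

lemma sum_abs_sub_le_one {g : ℕ → ℝ} (hg : Monotone g) (h0 : 0 ≤ g 0) (d : ℕ) (h1 : g d ≤ 1) :
    ∑ i ∈ range d, |g (i + 1) - g i| ≤ 1 := by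
  rw [Finset.sum_congr rfl fun i _ => abs_of_nonneg (sub_nonneg.2 (hg i.le_succ)),
    Finset.sum_range_sub]
  linarith

/-- An interval is a difference of two threshold functions, and disjointness allows at most one
nonzero summand. -/
lemma indicator_intervalUnion {s : ℕ} (a b : Fin s → ℤ) (hab : ∀ i, a i ≤ b i)
    (hba : ∀ i j, i < j → b i + 1 < a j) (z : ℤ) [Decidable (z ∈ ⋃ i, Set.Icc (a i) (b i))] :
    (if z ∈ ⋃ i, Set.Icc (a i) (b i) then (1 : ℝ) else 0)
      = ∑ j, ((if a j ≤ z then 1 else 0) - (if b j + 1 ≤ z then 1 else 0)) := by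
  have h (j : Fin s) : ((if a j ≤ z then 1 else 0) - (if b j + 1 ≤ z then 1 else 0) : ℝ)
      = if z ∈ Set.Icc (a j) (b j) then 1 else 0 := by
    have := hab j
    simp only [Set.mem_Icc]
    split_ifs <;> first | omega | norm_num
  simp_rw [h]
  split_ifs with hz
  · obtain ⟨j, hj⟩ := Set.mem_iUnion.1 hz
    rw [Finset.sum_eq_single j, if_pos hj]
    · intro k _ hk
      rw [if_neg]
      rintro ⟨h1, h2⟩
      rcases lt_or_gt_of_ne hk with h3 | h3
      · have := hba _ _ h3; have := hj.1; omega
      · have := hba _ _ h3; have := hj.2; omega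
    · simp
  · rw [Finset.sum_eq_zero]
    intro j _
    rw [if_neg fun hj => hz (Set.mem_iUnion.2 ⟨j, hj⟩)]

/-- The fluctuation of the indicator of `s` intervals is at most `2 * s`. -/
lemma fluctuation_sumIndicator_le {s : ℕ} {I : Set ℤ} (hI : IsIntervalUnion s I) :
    (sumIndicator d I).fluctuation ≤ 2 * s := by
  classical
  obtain ⟨a, b, hab, hba, rfl⟩ := hI
  -- Level i has coordinate sum 2i - d. Each threshold is monotone in i with values in [0, 1], so
  -- its total variation is at most 1, and every interval contributes two thresholds.
  set g : ℤ → ℕ → ℝ := fun t i => if t ≤ 2 * (i : ℤ) - d then 1 else 0 with hg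
  have hgm (t : ℤ) : ∑ i ∈ range d, |g t (i + 1) - g t i| ≤ 1 := by
    refine sum_abs_sub_le_one ?_ ?_ d ?_
    · intro i j hij
      simp only [hg]
      split_ifs
      · exact le_rfl
      · omega
      · norm_num
      · exact le_rfl
    · simp only [hg]; split_ifs <;> norm_num
    · simp only [hg]; split_ifs <;> norm_num
  have hval {i : ℕ} (hi : i ≤ d) :
      ((sumIndicator d (⋃ i, Set.Icc (a i) (b i))) (levelPoint d i) : ℝ)
        = ∑ j, (g (a j) i - g (b j + 1) i) := by
    rw [sumIndicator, sum_levelPoint hi, ← indicator_intervalUnion a b hab hba]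
    split_ifs <;> simp
  calc (sumIndicator d (⋃ i, Set.Icc (a i) (b i))).fluctuation
      ≤ ∑ i ∈ range d, ∑ j, (|g (a j) (i + 1) - g (a j) i|
          + |g (b j + 1) (i + 1) - g (b j + 1) i|) := by
        refine Finset.sum_le_sum fun i hi => ?_
        rw [mem_range] at hi
        rw [hval (by omega), hval (by omega), ← Finset.sum_sub_distrib]
        refine (Finset.abs_sum_le_sum_abs _ _).trans (Finset.sum_le_sum fun j _ => ?_)
        rw [show g (a j) (i + 1) - g (b j + 1) (i + 1) - (g (a j) i - g (b j + 1) i)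
          = (g (a j) (i + 1) - g (a j) i) - (g (b j + 1) (i + 1) - g (b j + 1) i) by ring]
        exact abs_sub _ _
    _ ≤ ∑ _j : Fin s, (2 : ℝ) := by
        rw [Finset.sum_comm]
        refine Finset.sum_le_sum fun j _ => ?_
        rw [Finset.sum_add_distrib]
        linarith [hgm (a j), hgm (b j + 1)]
    _ = _ := by simp; ring

lemma sumIndicator_isEven {I : Set ℤ} (hI : ∀ z ∈ I, -z ∈ I) : (sumIndicator d I).IsEven := by
  intro x
  have h : ∑ i, (((-x) i : ℤˣ) : ℤ) ∈ I ↔ ∑ i, ((x i : ℤˣ) : ℤ) ∈ I := by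
    have e : ∑ i, (((-x) i : ℤˣ) : ℤ) = -∑ i, ((x i : ℤˣ) : ℤ) := by
      rw [← Finset.sum_neg_distrib]
      exact Finset.sum_congr rfl fun i _ => by simp
    rw [e]
    exact ⟨fun h => by simpa using hI _ h, hI _⟩
  simp only [sumIndicator]
  by_cases hx : ∑ i, ((x i : ℤˣ) : ℤ) ∈ I
  · rw [if_pos hx, if_pos (h.2 hx)]
  · rw [if_neg hx, if_neg fun hx' => hx (h.1 hx')]

lemma mean_sumIndicator_empty : ((sumIndicator d ∅).mean : ℝ) = 0 := by
  rw [mean_eq_expect]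
  simp [sumIndicator]

lemma pos_of_isIntervalUnion {s : ℕ} {I : Set ℤ} (hI : IsIntervalUnion s I)
    (h : 0 < ((sumIndicator d I).mean : ℝ)) : 1 ≤ s := by
  by_contra hs
  obtain rfl : s = 0 := by omega
  obtain ⟨a, b, -, -, rfl⟩ := hI
  simp [mean_sumIndicator_empty] at h

lemma log_one_div_sq_le {p c : ℝ} (hc : 0 < c) (hcp : c ≤ p) (hp : p ≤ 1) :
    Real.log (1 / p) ^ 2 ≤ Real.log (1 / c) ^ 2 := by
  have hp0 : 0 < p := hc.trans_le hcp
  have h0 : 0 ≤ Real.log (1 / p) := Real.log_nonneg (by rw [le_div_iff₀ hp0]; linarith)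
  have h1 : Real.log (1 / p) ≤ Real.log (1 / c) :=
    Real.log_le_log (by positivity) (one_div_le_one_div_of_le hc hcp)
  gcongr

lemma natCast_le_rpow_three_halves {n : ℕ} (hn : 1 ≤ n) : (n : ℝ) ≤ (n : ℝ) ^ (3 / 2 : ℝ) := by
  have h : (1 : ℝ) ≤ n := by exact_mod_cast hn
  simpa using Real.rpow_le_rpow_of_exponent_le h (show (1 : ℝ) ≤ 3 / 2 by norm_num)

end Connection

theorem corollary4p10 :
    ∃ K : ℝ, 0 < K ∧
      ∀ (d : ℕ → ℕ) (σ : (n : ℕ) → Connection (d n)) (p : ℕ → ℝ),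
        (∀ n, (σ n).IsSymmetric) →
        (∀ n, p n = (σ n).mean) →
        (∃ c : ℝ, 0 < c ∧ ∀ᶠ n in atTop, p n ≤ 1 - c) →
        -- the general case and the even case
        ((∀ᶠ n : ℕ in atTop, K * n * Real.log n ≤ d n) →
          ((fun n : ℕ => max ((n : ℝ) ^ 3 * p n ^ 2 * Real.log (1 / p n) ^ 2)
              ((n : ℝ) ^ (3 / 2 : ℝ) * (σ n).fluctuation ^ 2 / p n))
            =o[atTop] fun n => (d n : ℝ)) →
          Tendsto (fun n => (σ n).klToBinomial n) atTop (𝓝 0)) ∧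
        ((∀ᶠ n : ℕ in atTop, K * n * Real.log n ≤ d n) →
          (∀ᶠ n in atTop, (σ n).IsEven ∧ Even (d n)) →
          ((fun n : ℕ => max ((n : ℝ) ^ (3 / 2 : ℝ) * p n * Real.log (1 / p n) ^ 2)
              ((n : ℝ) ^ (3 / 2 : ℝ) * (σ n).fluctuation ^ 2 / p n))
            =o[atTop] fun n => (d n : ℝ)) →
          Tendsto (fun n => (σ n).klToBinomial n) atTop (𝓝 0)) ∧
        -- indicators of unions of `s n` intervals, first for arbitrary and then for dense `p`
        (∀ (s : ℕ → ℕ) (I : ℕ → Set ℤ),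
          (∀ n, IsIntervalUnion (s n) (I n)) →
          (∀ n, σ n = Connection.sumIndicator (d n) (I n)) →
          ((∀ᶠ n : ℕ in atTop, K * n * Real.log n ≤ d n) →
            ((fun n : ℕ => max ((n : ℝ) ^ 3 * p n ^ 2 * Real.log (1 / p n) ^ 2)
                ((n : ℝ) ^ (3 / 2 : ℝ) * (2 * s n : ℝ) ^ 2 / p n))
              =o[atTop] fun n => (d n : ℝ)) →
            Tendsto (fun n => (σ n).klToBinomial n) atTop (𝓝 0)) ∧
          ((∀ᶠ n : ℕ in atTop, K * n * Real.log n ≤ d n) →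
            (∀ᶠ n in atTop, (∀ z ∈ I n, -z ∈ I n) ∧ Even (d n)) →
            ((fun n : ℕ => max ((n : ℝ) ^ (3 / 2 : ℝ) * p n * Real.log (1 / p n) ^ 2)
                ((n : ℝ) ^ (3 / 2 : ℝ) * (2 * s n : ℝ) ^ 2 / p n))
              =o[atTop] fun n => (d n : ℝ)) →
            Tendsto (fun n => (σ n).klToBinomial n) atTop (𝓝 0)) ∧
          ((∃ c : ℝ, 0 < c ∧ ∀ᶠ n in atTop, c ≤ p n) →
            ((fun n : ℕ => (n : ℝ) ^ 3 + (n : ℝ) ^ (3 / 2 : ℝ) * (s n : ℝ) ^ 2)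
              =o[atTop] fun n => (d n : ℝ)) →
            Tendsto (fun n => (σ n).klToBinomial n) atTop (𝓝 0)) ∧
          ((∃ c : ℝ, 0 < c ∧ ∀ᶠ n in atTop, c ≤ p n) →
            (∀ᶠ n in atTop, (∀ z ∈ I n, -z ∈ I n) ∧ Even (d n)) →
            ((fun n : ℕ => (n : ℝ) ^ (3 / 2 : ℝ) * (s n : ℝ) ^ 2)
              =o[atTop] fun n => (d n : ℝ)) →
            Tendsto (fun n => (σ n).klToBinomial n) atTop (𝓝 0))) := by
  -- K = 1 suffices, since any positive multiple of n log n forces n/d → 0.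
  refine ⟨1, one_pos, fun d σ p hσ hp ⟨c, hc0, hpc⟩ => ⟨fun hd h => ?_, fun hd he h => ?_,
    fun s I hI hσI => ⟨fun hd h => ?_, fun hd he h => ?_, fun ⟨c', hc', hcp⟩ h => ?_,
      fun ⟨c', hc', hcp⟩ he h => ?_⟩⟩⟩
  · obtain ⟨hnd, hd0⟩ := Connection.eventually_dim_pos_of_mul_log_le hd
    exact Connection.tendsto_klToBinomial_of_fluctuation_le hσ hp hc0 hpc (fun _ => le_rfl) hd0
      hnd h
  · obtain ⟨hnd, hd0⟩ := Connection.eventually_dim_pos_of_mul_log_le hd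
    exact Connection.tendsto_klToBinomial_of_isEven hσ hp hc0 hpc (fun _ => le_rfl) hd0 hnd he h
  all_goals
    have hF (n : ℕ) : (σ n).fluctuation ≤ 2 * s n := by
      rw [hσI n]
      exact Connection.fluctuation_sumIndicator_le (hI n)
  · obtain ⟨hnd, hd0⟩ := Connection.eventually_dim_pos_of_mul_log_le hd
    exact Connection.tendsto_klToBinomial_of_fluctuation_le hσ hp hc0 hpc hF hd0 hnd h
  · obtain ⟨hnd, hd0⟩ := Connection.eventually_dim_pos_of_mul_log_le hd
    refine Connection.tendsto_klToBinomial_of_isEven hσ hp hc0 hpc hF hd0 hnd ?_ h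
    filter_upwards [he] with n hn
    exact ⟨by rw [hσI n]; exact Connection.sumIndicator_isEven hn.1, hn.2⟩
  all_goals have hp1 (n : ℕ) : p n ≤ 1 := by rw [hp]; exact (σ n).mean.2.2
  · obtain ⟨hnd, hd0⟩ := Connection.eventually_dim_pos_of_isLittleO (f := fun n : ℕ => (n : ℝ) ^ 3
      + (n : ℝ) ^ (3 / 2 : ℝ) * (s n : ℝ) ^ 2) (by
        filter_upwards [eventually_ge_atTop 1] with n hn
        have h1 : (1 : ℝ) ≤ n := by exact_mod_cast hn
        have h2 : (n : ℝ) ≤ n ^ 3 := le_self_pow₀ h1 (by norm_num)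
        have h3 : (0 : ℝ) ≤ (n : ℝ) ^ (3 / 2 : ℝ) * (s n : ℝ) ^ 2 := by positivity
        linarith) h
    -- For c' ≤ p ≤ 1, p² log²(1/p) is at most log²(1/c'), and (2s)²/p is at most 4s²/c'.
    refine Connection.tendsto_klToBinomial_of_fluctuation_le hσ hp hc0 hpc hF hd0 hnd
      (IsBigO.trans_isLittleO (IsBigO.of_bound (Real.log (1 / c') ^ 2 + 4 / c') ?_) h)
    filter_upwards [hcp] with n hn
    have hpn : 0 < p n := hc'.trans_le hn
    have hL := Connection.log_one_div_sq_le hc' hn (hp1 n)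
    rw [Real.norm_of_nonneg (by positivity), Real.norm_of_nonneg (by positivity)]
    have e1 : (n : ℝ) ^ 3 * p n ^ 2 * Real.log (1 / p n) ^ 2
        ≤ (n : ℝ) ^ 3 * 1 ^ 2 * Real.log (1 / c') ^ 2 := by
      have := hp1 n
      gcongr
    have e2 : (n : ℝ) ^ (3 / 2 : ℝ) * (2 * s n : ℝ) ^ 2 / p n
        ≤ (n : ℝ) ^ (3 / 2 : ℝ) * (2 * s n : ℝ) ^ 2 / c' := by gcongr
    have e3 : (n : ℝ) ^ (3 / 2 : ℝ) * (2 * s n : ℝ) ^ 2 / c'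
        = 4 / c' * ((n : ℝ) ^ (3 / 2 : ℝ) * (s n : ℝ) ^ 2) := by ring
    have f1 : 0 ≤ (n : ℝ) ^ 3 := by positivity
    have f2 : 0 ≤ (n : ℝ) ^ (3 / 2 : ℝ) * (s n : ℝ) ^ 2 := by positivity
    have f3 : 0 ≤ Real.log (1 / c') ^ 2 := by positivity
    have f4 : 0 ≤ 4 / c' := by positivity
    refine max_le ?_ ?_ <;>
      nlinarith [mul_nonneg f1 f4, mul_nonneg f1 f3, mul_nonneg f2 f3, mul_nonneg f2 f4]
  -- A positive mean excludes s = 0. Then s² ≥ 1, so n^{3/2} s² dominates both n and the level-2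
  -- term n^{3/2} p log²(1/p).
  · have hs : ∀ᶠ n in atTop, (1 : ℝ) ≤ (s n : ℝ) ^ 2 := by
      filter_upwards [hcp] with n hn
      have h1 : 1 ≤ s n := by
        refine Connection.pos_of_isIntervalUnion (d := d n) (hI n) ?_
        rw [← hσI n, ← hp]
        exact hc'.trans_le hn
      have h2 : (1 : ℝ) ≤ s n := by exact_mod_cast h1
      exact one_le_pow₀ h2
    obtain ⟨hnd, hd0⟩ := Connection.eventually_dim_pos_of_isLittleO
      (f := fun n : ℕ => (n : ℝ) ^ (3 / 2 : ℝ) * (s n : ℝ) ^ 2) (by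
        filter_upwards [hs, eventually_ge_atTop 1] with n hsn hn
        have h1 := Connection.natCast_le_rpow_three_halves hn
        have h2 : (0 : ℝ) ≤ (n : ℝ) ^ (3 / 2 : ℝ) := by positivity
        nlinarith) h
    refine Connection.tendsto_klToBinomial_of_isEven hσ hp hc0 hpc hF hd0 hnd ?_
      (IsBigO.trans_isLittleO (IsBigO.of_bound (Real.log (1 / c') ^ 2 + 4 / c') ?_) h)
    · filter_upwards [he] with n hn
      exact ⟨by rw [hσI n]; exact Connection.sumIndicator_isEven hn.1, hn.2⟩
    filter_upwards [hcp, hs] with n hn hsn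
    have hpn : 0 < p n := hc'.trans_le hn
    have hL := Connection.log_one_div_sq_le hc' hn (hp1 n)
    rw [Real.norm_of_nonneg (by positivity), Real.norm_of_nonneg (by positivity)]
    have e1 : (n : ℝ) ^ (3 / 2 : ℝ) * p n * Real.log (1 / p n) ^ 2
        ≤ (n : ℝ) ^ (3 / 2 : ℝ) * (s n : ℝ) ^ 2 * Real.log (1 / c') ^ 2 := by
      have := (hp1 n).trans hsn
      gcongr
    have e2 : (n : ℝ) ^ (3 / 2 : ℝ) * (2 * s n : ℝ) ^ 2 / p n
        ≤ (n : ℝ) ^ (3 / 2 : ℝ) * (2 * s n : ℝ) ^ 2 / c' := by gcongr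
    have e3 : (n : ℝ) ^ (3 / 2 : ℝ) * (2 * s n : ℝ) ^ 2 / c'
        = 4 / c' * ((n : ℝ) ^ (3 / 2 : ℝ) * (s n : ℝ) ^ 2) := by ring
    have f2 : 0 ≤ (n : ℝ) ^ (3 / 2 : ℝ) * (s n : ℝ) ^ 2 := by positivity
    have f3 : 0 ≤ Real.log (1 / c') ^ 2 := by positivity
    have f4 : 0 ≤ 4 / c' := by positivity
    refine max_le ?_ ?_ <;> nlinarith [mul_nonneg f2 f3, mul_nonneg f2 f4]
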